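/- All vector spaces are over $\mathbb C$. Let $\mathfrak g=\mathfrak g_{\bar0}\oplus\mathfrak g_{\bar1}$ be a finite-dimensional simple Lie superalgebra, let $A$ be a finitely generated commutative associative unital $\mathbb C$-algebra, and let $\Gamma$ be a finite abelian group acting by automorphisms on $\mathfrak g$ and on $A$, such that the induced action on the set of maximal ideals of $A$ is free. For a $\Gamma$-invariant ideal $I\subseteq A$, let $\Gamma$ act diagonally on $\mathfrak g\otimes P$ for $P=A,\,A/I,\,I,\,I/I^2$, and let $(\mathfrak g\otimes P)^\Gamma$ denote the fixed points. Then $(\mathfrak g\otimes A)^\Gamma$ and $(\mathfrak g\otimes A/I)^\Gamma$ are Lie superalgebras with bracket $[x\otimes a,y\otimes b]=[x,y]\otimes ab$, and $(\mathfrak g\otimes I/I^2)^\Gamma$ is a $(\mathfrak g\otimes A/I)^\Gamma$-module by the same formula. For a Lie superalgebra $\mathfrak l$ and a ($\mathbb Z_2$-graded) $\mathfrak l$-module $M$, let $\mathrm H^n(\mathfrak l,M)=\mathrm H^n_{\bar0}(\mathfrak l,M)\oplus \mathrm H^n_{\bar1}(\mathfrak l,M)$ be the cohomology of the $\mathbb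 Z_2$-graded Chevalley--Eilenberg complex $\mathrm{Hom}_{\mathbb C}(\Lambda^\bullet\mathfrak l,M)$; on homogeneous elements $$(d^1f)(x,y)=(-1)^{|x||f|}x f(y)-(-1)^{|y|(|x|+|f|)}y f(x)-f([x,y]).$$ Let $M$ be a finite-dimensional ($\mathbb Z_2$-graded) $(\mathfrak g\otimes A)^\Gamma$-module. Then there is a $\Gamma$-invariant ideal $I\subseteq A$ of finite codimension such that the action of $(\mathfrak g\otimes A)^\Gamma$ on $M$ factors through the projection $(\mathfrak g\otimes A)^\Gamma\to(\mathfrak g\otimes A/I)^\Gamma$, and such that there is an isomorphism of $\mathbb Z_2$-graded vector spaces $$\mathrm H^1\big((\mathfrak g\otimes A)^\Gamma,M\big)\;\cong\;\mathrm H^1\big((\mathfrak g\otimes A/I)^\Gamma,M\big)\oplus H',$$ that is, an isomorphism in each parity $z\in\mathbb Z_2$. Here $H'$ is the kernel of the transgression $$t\colon \mathrm{Hom}_{(\mathfrak g\otimes A/I)^\Gamma}\big((\mathfrak g\otimes I/I^2)^\Gamma,M\big)\to \mathrm H^2\big((\mathfrak g\otimes A/I)^\Gamma,M\big)$$ induced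 by $d^1$: given a homogeneous homomorphism $\varphi$ (where $\varphi(xn)=(-1)^{|x||\varphi|}x\varphi(n)$), compose it with the projection $(\mathfrak g\otimes I)^\Gamma\to(\mathfrak g\otimes I/I^2)^\Gamma$, extend the result to a linear map $\psi\colon(\mathfrak g\otimes A)^\Gamma\to M$ of the same parity, and let $t(\varphi)$ be the class of the $2$-cocycle on $(\mathfrak g\otimes A/I)^\Gamma$ induced by $d^1\psi$; it does not depend on the choice of $\psi$. -/

import Mathlib

open scoped TensorProduct

noncomputable section

/-! ### Super vector spaces, Lie superalgebras and their modules over `ℂ` -/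

/-- The sign `(-1)^{ij}` for parities `i, j ∈ ℤ/2`. -/
def superSign (i j : ZMod 2) : ℂ := if i = 1 ∧ j = 1 then -1 else 1

/-- A super vector space: `V = V₀ ⊕ V₁`. -/
class SuperSpace (V : Type*) [AddCommGroup V] [Module ℂ V] where
  /-- the homogeneous components -/
  gr : ZMod 2 → Submodule ℂ V
  isCompl : IsCompl (gr 0) (gr 1)

namespace SuperSpace

variable {V : Type*} [AddCommGroup V] [Module ℂ V] [SuperSpace V]

/-- The projection of `V = V₀ ⊕ V₁` onto `Vᵢ`, as an endomorphism of `V`. -/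
def proj (i : ZMod 2) : V →ₗ[ℂ] V :=
  if i = 0 then (gr 0 : Submodule ℂ V).projection (gr 1) isCompl
  else (gr 1 : Submodule ℂ V).projection (gr 0) isCompl.symm

/-- A subspace is graded if it contains the homogeneous components of its elements. -/
def IsGraded (W : Submodule ℂ V) : Prop := ∀ x ∈ W, ∀ i, proj i x ∈ W

theorem parity_cases (i : ZMod 2) : i = 0 ∨ i = 1 := by
  revert i; decide

theorem proj_mem (i : ZMod 2) (x : V) : proj i x ∈ (gr i : Submodule ℂ V) := by
  rcases parity_cases i with rfl | rfl
  · simp [proj]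
  · simp [proj]

theorem proj_of_mem {i : ZMod 2} {x : V} (hx : x ∈ (gr i : Submodule ℂ V)) (j : ZMod 2) :
    proj j x = if j = i then x else 0 := by
  rcases parity_cases i with rfl | rfl <;> rcases parity_cases j with rfl | rfl
  · simp [proj, Submodule.projection_apply_of_mem_left, hx]
  · simp [proj, hx]
  · simp [proj, hx]
  · simp [proj, Submodule.projection_apply_of_mem_left, hx]

theorem sum_proj (x : V) : ∑ i : ZMod 2, proj i x = x := by
  obtain ⟨a, ha, b, hb, rfl⟩ := Submodule.mem_sup.1
    (show x ∈ (gr 0 : Submodule ℂ V) ⊔ gr 1 by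
      rw [(isCompl (V := V)).sup_eq_top]; trivial)
  simp [map_add, proj_of_mem ha, proj_of_mem hb, Finset.sum_add_distrib]

/-- Two linear maps that agree on homogeneous elements are equal. -/
theorem hom_ext {W : Type*} [AddCommGroup W] [Module ℂ W] {f g : V →ₗ[ℂ] W}
    (h : ∀ i, ∀ x ∈ (gr i : Submodule ℂ V), f x = g x) : f = g := by
  ext x
  rw [← sum_proj x, map_sum, map_sum]
  exact Finset.sum_congr rfl fun i _ => h i _ (proj_mem i x)

end SuperSpace

open SuperSpace

/-- A Lie superalgebra over `ℂ`. -/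
class LieSuperalgebra (L : Type*) [AddCommGroup L] [Module ℂ L] extends SuperSpace L where
  /-- the superbracket -/
  bracket : L →ₗ[ℂ] L →ₗ[ℂ] L
  bracket_mem : ∀ {i j : ZMod 2} {x y : L}, x ∈ gr i → y ∈ gr j → bracket x y ∈ gr (i + j)
  bracket_skew : ∀ {i j : ZMod 2} {x y : L}, x ∈ gr i → y ∈ gr j →
    bracket x y = -(superSign i j • bracket y x)
  jacobi : ∀ {i j : ZMod 2} {x y : L}, x ∈ gr i → y ∈ gr j → ∀ w : L,
    bracket (bracket x y) w
      = bracket x (bracket y w) - superSign i j • bracket y (bracket x w)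

/-- A (left, `ℤ/2`-graded) module `M` over a Lie superalgebra `L`. -/
class LieSuperModule (L : Type*) [AddCommGroup L] [Module ℂ L] [LieSuperalgebra L]
    (M : Type*) [AddCommGroup M] [Module ℂ M] [SuperSpace M] where
  /-- the action `(x, m) ↦ x m` -/
  act : L →ₗ[ℂ] M →ₗ[ℂ] M
  act_mem : ∀ {i j : ZMod 2} {x : L} {m : M}, x ∈ (gr i : Submodule ℂ L) →
    m ∈ (gr j : Submodule ℂ M) → act x m ∈ (gr (i + j) : Submodule ℂ M)
  bracket_act : ∀ {i j : ZMod 2} {x y : L}, x ∈ (gr i : Submodule ℂ L) →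
    y ∈ (gr j : Submodule ℂ L) → ∀ m : M,
    act (LieSuperalgebra.bracket x y) m = act x (act y m) - superSign i j • act y (act x m)

open LieSuperalgebra LieSuperModule

namespace LieSuperalgebra

/-- Simplicity: the bracket is not zero and `0`, `L` are the only graded ideals. -/
def IsSimple (L : Type*) [AddCommGroup L] [Module ℂ L] [LieSuperalgebra L] : Prop :=
  (∃ x y : L, bracket x y ≠ 0) ∧
    ∀ J : Submodule ℂ L, IsGraded J → (∀ x : L, ∀ y ∈ J, bracket x y ∈ J) → J = ⊥ ∨ J = ⊤

/-- The automorphisms of a Lie superalgebra: invertible linear maps preserving the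
grading and the bracket. -/
def Aut (L : Type*) [AddCommGroup L] [Module ℂ L] [LieSuperalgebra L] :
    Subgroup (L ≃ₗ[ℂ] L) where
  carrier := {T | (∀ i, ∀ x, T x ∈ (gr i : Submodule ℂ L) ↔ x ∈ (gr i : Submodule ℂ L)) ∧
    ∀ x y : L, T (bracket x y) = bracket (T x) (T y)}
  mul_mem' := by
    rintro S T ⟨hS, hS'⟩ ⟨hT, hT'⟩
    exact ⟨fun i x => by simp [hS, hT], fun x y => by simp [hS', hT']⟩
  one_mem' := ⟨fun _ _ => Iff.rfl, fun _ _ => rfl⟩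
  inv_mem' := by
    rintro T ⟨hT, hT'⟩
    have key : ∀ x, T (T⁻¹ x) = x := fun x => T.apply_symm_apply x
    refine ⟨fun i x => ?_, fun x y => T.injective ?_⟩
    · rw [← hT i (T⁻¹ x), key]
    · rw [hT', key, key, key]

end LieSuperalgebra

/-! ### Cohomology in degrees one and two -/

/-- `Hom_ℂ(V, W)_z`: the linear maps `V → W` of parity `z`. -/
def HomDeg (z : ZMod 2) (V W : Type*) [AddCommGroup V] [Module ℂ V] [SuperSpace V]
    [AddCommGroup W] [Module ℂ W] [SuperSpace W] : Submodule ℂ (V →ₗ[ℂ] W) where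
  carrier := {f | ∀ i, ∀ x ∈ (gr i : Submodule ℂ V), f x ∈ (gr (i + z) : Submodule ℂ W)}
  add_mem' hf hg i x hx := add_mem (hf i x hx) (hg i x hx)
  zero_mem' _ _ _ := zero_mem _
  smul_mem' c _ hf i x hx := Submodule.smul_mem _ c (hf i x hx)

/-- `Hom_L(N, M)_z`: the parity `z` homomorphisms `φ : N → M` of `L`-modules, that is,
`φ(x n) = (-1)^{|x| z} x φ(n)`.  The space `Hom_L(N, M)` is the direct sum of these over `z`. -/
def ModHom (z : ZMod 2) (L N M : Type*) [AddCommGroup L] [Module ℂ L] [LieSuperalgebra L]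
    [AddCommGroup N] [Module ℂ N] [SuperSpace N] [LieSuperModule L N]
    [AddCommGroup M] [Module ℂ M] [SuperSpace M] [LieSuperModule L M] :
    Submodule ℂ (N →ₗ[ℂ] M) where
  carrier := {f | f ∈ HomDeg z N M ∧ ∀ i, ∀ x ∈ (gr i : Submodule ℂ L), ∀ n : N,
    f (act x n) = superSign i z • act x (f n)}
  add_mem' := by
    rintro f g ⟨hf, hf'⟩ ⟨hg, hg'⟩
    exact ⟨add_mem hf hg, fun i x hx n => by simp [hf' i x hx, hg' i x hx]⟩
  zero_mem' := ⟨zero_mem _, fun i x hx n => by simp⟩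
  smul_mem' := by
    rintro c f ⟨hf, hf'⟩
    exact ⟨Submodule.smul_mem _ c hf, fun i x hx n => by simp [hf' i x hx, smul_comm c]⟩

section Cohomology

variable (z : ZMod 2) (L : Type*) [AddCommGroup L] [Module ℂ L] [LieSuperalgebra L]
  (M : Type*) [AddCommGroup M] [Module ℂ M] [SuperSpace M] [LieSuperModule L M]

/-- The `2`-cochains of parity `z`, `Hom_ℂ(Λ² L, M)_z`: bilinear maps `L × L → M` of parity `z`
that are skew-symmetric in the super sense, written as linear maps on `L ⊗ L`. -/
def C2 : Submodule ℂ (L ⊗[ℂ] L →ₗ[ℂ] M) where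
  carrier := {c | ∀ i j, ∀ x ∈ (gr i : Submodule ℂ L), ∀ y ∈ (gr j : Submodule ℂ L),
    c (x ⊗ₜ y) ∈ (gr (i + j + z) : Submodule ℂ M) ∧
      c (x ⊗ₜ y) = -(superSign i j • c (y ⊗ₜ x))}
  add_mem' := by
    intro b c hb hc i j x hx y hy
    refine ⟨add_mem (hb i j x hx y hy).1 (hc i j x hx y hy).1, ?_⟩
    simp only [LinearMap.add_apply]
    rw [(hb i j x hx y hy).2, (hc i j x hx y hy).2]
    module
  zero_mem' := by
    intro i j x hx y hy
    simp
  smul_mem' := by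
    intro a c hc i j x hx y hy
    refine ⟨Submodule.smul_mem _ a (hc i j x hx y hy).1, ?_⟩
    simp only [LinearMap.smul_apply]
    rw [(hc i j x hx y hy).2]
    module

/-- The differential `d⁰` on `m` of parity `z`; on homogeneous elements
`(d⁰ m)(x) = (-1)^{|x| z} x m` (see `d0_apply`). -/
def d0 : M →ₗ[ℂ] L →ₗ[ℂ] M where
  toFun m := ∑ i : ZMod 2, superSign i z • (act (L := L) (M := M)).flip m ∘ₗ proj i
  map_add' m n := by ext x; simp [Finset.sum_add_distrib]
  map_smul' a m := by ext x; simp [Finset.smul_sum, smul_comm a]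

/-- The differential `d¹` on `f : L → M` of parity `z`; on homogeneous elements
`(d¹ f)(x, y) = (-1)^{|x| z} x f(y) - (-1)^{|y| (|x| + z)} y f(x) - f([x, y])`
(see `d1_apply`). -/
def d1 : (L →ₗ[ℂ] M) →ₗ[ℂ] L ⊗[ℂ] L →ₗ[ℂ] M where
  toFun f := TensorProduct.lift
    ((∑ i : ZMod 2, ∑ j : ZMod 2,
      (superSign i z • (act (L := L) (M := M)).compl₁₂ (proj i) (f ∘ₗ proj j)
        - superSign j (i + z) •
          ((act (L := L) (M := M)).compl₁₂ (proj j) (f ∘ₗ proj i)).flip))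
    - (bracket (L := L)).compr₂ f)
  map_add' f g := by
    ext x y
    simp only [TensorProduct.AlgebraTensorModule.curry_apply, LinearMap.restrictScalars_self,
      TensorProduct.curry_apply, TensorProduct.lift.tmul,
      LinearMap.sub_apply, LinearMap.add_apply, LinearMap.sum_apply,
      LinearMap.smul_apply, LinearMap.compl₁₂_apply, LinearMap.flip_apply, LinearMap.comp_apply,
      LinearMap.compr₂_apply, map_add, smul_add, Finset.sum_sub_distrib, Finset.sum_add_distrib]
    abel
  map_smul' a f := by
    ext x y
    simp only [TensorProduct.AlgebraTensorModule.curry_apply, LinearMap.restrictScalars_self,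
      TensorProduct.curry_apply, TensorProduct.lift.tmul,
      LinearMap.sub_apply, LinearMap.sum_apply,
      LinearMap.smul_apply, LinearMap.compl₁₂_apply, LinearMap.flip_apply, LinearMap.comp_apply,
      LinearMap.compr₂_apply, map_smul, smul_sub, Finset.smul_sum, smul_comm a, RingHom.id_apply]

variable {L M} in
theorem d0_apply {i : ZMod 2} {x : L} (hx : x ∈ (gr i : Submodule ℂ L)) (m : M) :
    d0 z L M m x = superSign i z • act x m := by
  simp only [d0, LinearMap.coe_mk, AddHom.coe_mk, LinearMap.sum_apply, LinearMap.smul_apply,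
    LinearMap.comp_apply, LinearMap.flip_apply, proj_of_mem hx]
  rw [Finset.sum_eq_single i] <;> simp +contextual

variable {L M} in
theorem d1_apply {i j : ZMod 2} {x y : L} (hx : x ∈ (gr i : Submodule ℂ L))
    (hy : y ∈ (gr j : Submodule ℂ L)) (f : L →ₗ[ℂ] M) :
    d1 z L M f (x ⊗ₜ y) = superSign i z • act x (f y) - superSign j (i + z) • act y (f x)
      - f (bracket x y) := by
  simp only [d1, LinearMap.coe_mk, AddHom.coe_mk, TensorProduct.lift.tmul,
    LinearMap.sub_apply, LinearMap.sum_apply,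
    LinearMap.smul_apply, LinearMap.compl₁₂_apply, LinearMap.flip_apply, LinearMap.comp_apply,
    LinearMap.compr₂_apply, proj_of_mem hx, proj_of_mem hy]
  congr 1
  rw [Finset.sum_eq_single i, Finset.sum_eq_single j] <;> simp +contextual

/-- The value on homogeneous `x, y, w` (of parities `i, j, k`) of the differential `d²` of a
`2`-cochain `c` of parity `z`. -/
def d2 (c : L ⊗[ℂ] L →ₗ[ℂ] M) (i j k : ZMod 2) (x y w : L) : M :=
  superSign i z • act x (c (y ⊗ₜ w)) - superSign j (z + i) • act y (c (x ⊗ₜ w))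
    + superSign k (z + i + j) • act w (c (x ⊗ₜ y))
    - c (bracket x y ⊗ₜ w) + superSign k j • c (bracket x w ⊗ₜ y) + c (x ⊗ₜ bracket y w)

/-- The `1`-cocycles of parity `z`. -/
def Z1 : Submodule ℂ (L →ₗ[ℂ] M) := HomDeg z L M ⊓ LinearMap.ker (d1 z L M)

/-- The `1`-coboundaries of parity `z`. -/
def B1 : Submodule ℂ (L →ₗ[ℂ] M) := (gr z : Submodule ℂ M).map (d0 z L M)

/-- The `2`-cocycles of parity `z`. -/
def Z2 : Submodule ℂ (L ⊗[ℂ] L →ₗ[ℂ] M) where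
  carrier := {c | c ∈ C2 z L M ∧ ∀ i j k, ∀ x ∈ (gr i : Submodule ℂ L),
    ∀ y ∈ (gr j : Submodule ℂ L), ∀ w ∈ (gr k : Submodule ℂ L), d2 z L M c i j k x y w = 0}
  add_mem' := by
    rintro b c ⟨hb, hb'⟩ ⟨hc, hc'⟩
    refine ⟨add_mem hb hc, fun i j k x hx y hy w hw => ?_⟩
    rw [← add_zero (0 : M)]
    nth_rw 1 [← hb' i j k x hx y hy w hw]
    rw [← hc' i j k x hx y hy w hw]
    simp only [d2, LinearMap.add_apply, map_add]
    module
  zero_mem' := ⟨zero_mem _, fun i j k x hx y hy w hw => by simp [d2]⟩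
  smul_mem' := by
    rintro a c ⟨hc, hc'⟩
    refine ⟨Submodule.smul_mem _ a hc, fun i j k x hx y hy w hw => ?_⟩
    rw [← smul_zero a, ← hc' i j k x hx y hy w hw]
    simp only [d2, LinearMap.smul_apply, map_smul]
    module

/-- The `2`-coboundaries of parity `z`. -/
def B2 : Submodule ℂ (L ⊗[ℂ] L →ₗ[ℂ] M) := (HomDeg z L M).map (d1 z L M)

/-- `H¹(L, M)_z`.  The space `H¹(L, M)` is the direct sum of these over `z`. -/
abbrev H1 : Type _ := Z1 z L M ⧸ (B1 z L M).submoduleOf (Z1 z L M)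

/-- `H²(L, M)_z`.  The space `H²(L, M)` is the direct sum of these over `z`. -/
abbrev H2 : Type _ := Z2 z L M ⧸ (B2 z L M).submoduleOf (Z2 z L M)

theorem B1_le_Z1 : B1 z L M ≤ Z1 z L M := by
  rintro _ ⟨m, hm, rfl⟩
  refine ⟨fun i x hx => ?_, LinearMap.mem_ker.2 ?_⟩
  · rw [d0_apply z hx]
    exact Submodule.smul_mem _ _ (act_mem hx hm)
  · refine TensorProduct.ext (hom_ext fun i x hx => hom_ext fun j y hy => ?_)
    change d1 z L M (d0 z L M m) (x ⊗ₜ y) = 0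
    rw [d1_apply z hx hy, d0_apply z hx, d0_apply z hy, d0_apply z (bracket_mem hx hy),
      bracket_act hx hy]
    rcases parity_cases i with rfl | rfl <;> rcases parity_cases j with rfl | rfl <;>
      rcases parity_cases z with rfl | rfl <;>
      simp [superSign, show (1 : ZMod 2) + 1 = 0 from rfl] <;> abel

theorem B2_le_Z2 : B2 z L M ≤ Z2 z L M := by
  rintro _ ⟨f, hf, rfl⟩
  refine ⟨fun i j x hx y hy => ⟨?_, ?_⟩, fun i j k x hx y hy w hw => ?_⟩
  · rw [d1_apply z hx hy]
    have h1 := act_mem hx (hf j y hy)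
    have h2 := act_mem hy (hf i x hx)
    have h3 := hf _ _ (bracket_mem hx hy)
    rw [show i + (j + z) = i + j + z by ring] at h1
    rw [show j + (i + z) = i + j + z by ring] at h2
    exact sub_mem (sub_mem (Submodule.smul_mem _ _ h1) (Submodule.smul_mem _ _ h2)) h3
  · rw [d1_apply z hx hy, d1_apply z hy hx, bracket_skew hx hy]
    rcases parity_cases i with rfl | rfl <;> rcases parity_cases j with rfl | rfl <;>
      rcases parity_cases z with rfl | rfl <;>
      simp [superSign, show (1 : ZMod 2) + 1 = 0 from rfl] <;> abel
  · simp only [d2]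
    rw [d1_apply z hx hy, d1_apply z hx hw, d1_apply z hy hw,
      d1_apply z (bracket_mem hx hy) hw, d1_apply z (bracket_mem hx hw) hy,
      d1_apply z hx (bracket_mem hy hw), bracket_act hx hy, bracket_act hx hw,
      bracket_act hy hw, jacobi hx hy w]
    have e : bracket (bracket x w) y
        = -(superSign (i + k) j • bracket y (bracket x w)) := bracket_skew (bracket_mem hx hw) hy
    rw [e]
    rcases parity_cases i with rfl | rfl <;> rcases parity_cases j with rfl | rfl <;>
      rcases parity_cases k with rfl | rfl <;>
      rcases parity_cases z with rfl | rfl <;>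
      simp [superSign, show (1 : ZMod 2) + 1 = 0 from rfl] <;> abel

end Cohomology

/-! ### The transgression of an extension of Lie superalgebras -/

section HomPart

variable {V W : Type*} [AddCommGroup V] [Module ℂ V] [SuperSpace V]
  [AddCommGroup W] [Module ℂ W] [SuperSpace W]

/-- The component of parity `z` of a linear map. -/
def homPart (z : ZMod 2) (f : V →ₗ[ℂ] W) : V →ₗ[ℂ] W :=
  ∑ i : ZMod 2, proj (i + z) ∘ₗ f ∘ₗ proj i

theorem homPart_apply {z i : ZMod 2} {x : V} (hx : x ∈ (gr i : Submodule ℂ V))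
    (f : V →ₗ[ℂ] W) : homPart z f x = proj (i + z) (f x) := by
  simp only [homPart, LinearMap.sum_apply, LinearMap.comp_apply, proj_of_mem hx]
  rw [Finset.sum_eq_single i] <;> simp +contextual

theorem homPart_mem (z : ZMod 2) (f : V →ₗ[ℂ] W) : homPart z f ∈ HomDeg z V W := by
  intro i x hx
  rw [homPart_apply hx]
  exact proj_mem _ _

theorem homPart_add (z : ZMod 2) (f g : V →ₗ[ℂ] W) :
    homPart z (f + g) = homPart z f + homPart z g :=
  hom_ext fun i x hx => by simp [homPart_apply hx]

theorem homPart_smul (z : ZMod 2) (a : ℂ) (f : V →ₗ[ℂ] W) :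
    homPart z (a • f) = a • homPart z f :=
  hom_ext fun i x hx => by simp [homPart_apply hx]

theorem proj_of_even {f : V →ₗ[ℂ] W} (hf : f ∈ HomDeg 0 V W) (i : ZMod 2) (x : V) :
    proj i (f x) = f (proj i x) := by
  have : proj i ∘ₗ f = f ∘ₗ proj i := hom_ext fun j y hy => by
    have h := hf j y hy
    rw [add_zero] at h
    simp only [LinearMap.comp_apply, proj_of_mem hy, proj_of_mem h]
    split_ifs <;> simp
  exact LinearMap.congr_fun this x

end HomPart

/-- An extension `0 → K → L → Q → 0` of the Lie superalgebra `Q` by an ideal `K` of `L`, with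
projection `π` and inclusion `ι`, together with an even linear map `q` from `K` to a `Q`-module
`N` such that `q([x, k]) = π(x) q(k)`. -/
structure SuperExtension (K L Q N : Type*) [AddCommGroup K] [Module ℂ K] [SuperSpace K]
    [AddCommGroup L] [Module ℂ L] [LieSuperalgebra L]
    [AddCommGroup Q] [Module ℂ Q] [LieSuperalgebra Q]
    [AddCommGroup N] [Module ℂ N] [SuperSpace N] [LieSuperModule Q N] where
  /-- the inclusion -/
  ι : K →ₗ[ℂ] L
  /-- the projection -/
  π : L →ₗ[ℂ] Q
  /-- the map to the module -/
  q : K →ₗ[ℂ] N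
  ι_even : ι ∈ HomDeg 0 K L
  π_even : π ∈ HomDeg 0 L Q
  q_even : q ∈ HomDeg 0 K N
  ι_injective : Function.Injective ι
  π_surjective : Function.Surjective π
  π_ι : ∀ k, π (ι k) = 0
  exact : ∀ x, π x = 0 → ∃ k, ι k = x
  π_bracket : ∀ x y, π (bracket x y) = bracket (π x) (π y)
  bracket_ι : ∀ (x : L) (k : K), ∃ k', ι k' = bracket x (ι k) ∧ q k' = act (π x) (q k)

namespace SuperExtension

variable {K L Q N : Type*} [AddCommGroup K] [Module ℂ K] [SuperSpace K]
    [AddCommGroup L] [Module ℂ L] [LieSuperalgebra L]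
    [AddCommGroup Q] [Module ℂ Q] [LieSuperalgebra Q]
    [AddCommGroup N] [Module ℂ N] [SuperSpace N] [LieSuperModule Q N]
    (E : SuperExtension K L Q N)
    {M : Type*} [AddCommGroup M] [Module ℂ M] [SuperSpace M] (z : ZMod 2)

/-- A linear retraction of the inclusion. -/
def retr : L →ₗ[ℂ] K :=
  (E.ι.exists_leftInverse_of_injective (LinearMap.ker_eq_bot.2 E.ι_injective)).choose

theorem retr_ι (k : K) : E.retr (E.ι k) = k :=
  LinearMap.congr_fun
    (E.ι.exists_leftInverse_of_injective (LinearMap.ker_eq_bot.2 E.ι_injective)).choose_spec k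

/-- A linear section of the projection. -/
def sect : Q →ₗ[ℂ] L :=
  (E.π.exists_rightInverse_of_surjective (LinearMap.range_eq_top.2 E.π_surjective)).choose

theorem π_sect (x : Q) : E.π (E.sect x) = x :=
  LinearMap.congr_fun
    (E.π.exists_rightInverse_of_surjective (LinearMap.range_eq_top.2 E.π_surjective)).choose_spec x

/-- The extension to `L`, of parity `z`, of the linear map `φ ∘ q` on `K`, for `φ : N → M`. -/
def ext : (N →ₗ[ℂ] M) →ₗ[ℂ] L →ₗ[ℂ] M where
  toFun φ := homPart z (φ ∘ₗ E.q ∘ₗ E.retr)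
  map_add' f g := by rw [LinearMap.add_comp, homPart_add]
  map_smul' a f := by rw [LinearMap.smul_comp, homPart_smul]; rfl

theorem ext_mem (φ : N →ₗ[ℂ] M) : E.ext z φ ∈ HomDeg z L M := homPart_mem _ _

theorem ext_ι {φ : N →ₗ[ℂ] M} (hφ : φ ∈ HomDeg z N M) (k : K) :
    E.ext z φ (E.ι k) = φ (E.q k) := by
  have : E.ext z φ ∘ₗ E.ι = φ ∘ₗ E.q := hom_ext fun i k hk => by
    have h1 := E.ι_even i k hk
    have h2 := E.q_even i k hk
    rw [add_zero] at h1 h2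
    change homPart z (φ ∘ₗ E.q ∘ₗ E.retr) (E.ι k) = φ (E.q k)
    rw [homPart_apply h1]
    simp only [LinearMap.comp_apply, E.retr_ι]
    rw [proj_of_mem (hφ i _ h2), if_pos rfl]
  exact LinearMap.congr_fun this k

variable [LieSuperModule L M] [LieSuperModule Q M]

/-- If `ψ` extends `φ ∘ q`, with `φ` a homomorphism of modules, then `d¹ ψ` vanishes when one
argument is in `K`. -/
theorem d1_ι_right (hM : ∀ (x : L) (m : M), act (E.π x) m = act x m)
    {φ : N →ₗ[ℂ] M} (hφ : φ ∈ ModHom z Q N M) {ψ : L →ₗ[ℂ] M}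
    (hψ : ∀ k, ψ (E.ι k) = φ (E.q k)) (x : L) (k : K) :
    d1 z L M ψ (x ⊗ₜ E.ι k) = 0 := by
  have : (TensorProduct.curry (d1 z L M ψ)).compl₂ E.ι = 0 := by
    refine hom_ext fun i x hx => hom_ext fun j k hk => ?_
    change d1 z L M ψ (x ⊗ₜ E.ι k) = 0
    have h1 := E.ι_even j k hk
    have h2 := E.π_even i x hx
    rw [add_zero] at h1 h2
    obtain ⟨k', hk', hq⟩ := E.bracket_ι x k
    rw [d1_apply z hx h1, hψ, ← hk', hψ, hq, hφ.2 i _ h2, ← hM (E.ι k), E.π_ι, hM]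
    simp
  exact LinearMap.congr_fun₂ this x k

theorem d1_ι_left (hM : ∀ (x : L) (m : M), act (E.π x) m = act x m)
    {φ : N →ₗ[ℂ] M} (hφ : φ ∈ ModHom z Q N M) {ψ : L →ₗ[ℂ] M} (hψz : ψ ∈ HomDeg z L M)
    (hψ : ∀ k, ψ (E.ι k) = φ (E.q k)) (k : K) (x : L) :
    d1 z L M ψ (E.ι k ⊗ₜ x) = 0 := by
  have : (TensorProduct.curry (d1 z L M ψ)) ∘ₗ E.ι = 0 := by
    refine hom_ext fun i k hk => hom_ext fun j x hx => ?_
    change d1 z L M ψ (E.ι k ⊗ₜ x) = 0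
    have h1 := E.ι_even i k hk
    rw [add_zero] at h1
    have h := (B2_le_Z2 z L M (Submodule.mem_map_of_mem hψz)).1 i j _ h1 x hx
    rw [h.2, E.d1_ι_right z hM hφ hψ]
    simp
  exact LinearMap.congr_fun₂ this k x

theorem d1_congr (hM : ∀ (x : L) (m : M), act (E.π x) m = act x m)
    {φ : N →ₗ[ℂ] M} (hφ : φ ∈ ModHom z Q N M) {ψ : L →ₗ[ℂ] M} (hψz : ψ ∈ HomDeg z L M)
    (hψ : ∀ k, ψ (E.ι k) = φ (E.q k)) {x x' y y' : L} (hx : E.π x = E.π x')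
    (hy : E.π y = E.π y') : d1 z L M ψ (x ⊗ₜ y) = d1 z L M ψ (x' ⊗ₜ y') := by
  obtain ⟨k, hk⟩ := E.exact (x - x') (by rw [map_sub, hx, sub_self])
  obtain ⟨l, hl⟩ := E.exact (y - y') (by rw [map_sub, hy, sub_self])
  rw [← sub_add_cancel x x', ← hk, TensorProduct.add_tmul, map_add,
    E.d1_ι_left z hM hφ hψz hψ, zero_add, ← sub_add_cancel y y', ← hl, TensorProduct.tmul_add,
    map_add, E.d1_ι_right z hM hφ hψ, zero_add]

/-- The bilinear map on `Q` induced by `d¹` of an extension of `φ ∘ q` to `L`. -/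
def cocycle : (N →ₗ[ℂ] M) →ₗ[ℂ] Q ⊗[ℂ] Q →ₗ[ℂ] M :=
  (TensorProduct.map E.sect E.sect).lcomp ℂ M ∘ₗ d1 z L M ∘ₗ E.ext z

theorem cocycle_apply (hM : ∀ (x : L) (m : M), act (E.π x) m = act x m)
    {φ : N →ₗ[ℂ] M} (hφ : φ ∈ ModHom z Q N M) (x y : L) :
    E.cocycle (M := M) z φ (E.π x ⊗ₜ E.π y) = d1 z L M (E.ext z φ) (x ⊗ₜ y) := by
  change d1 z L M (E.ext z φ) (E.sect (E.π x) ⊗ₜ E.sect (E.π y)) = _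
  exact E.d1_congr z hM hφ (E.ext_mem z φ) (E.ext_ι z hφ.1) (E.π_sect _) (E.π_sect _)

/-- A homogeneous element of `Q` has a homogeneous lift. -/
theorem exists_lift {i : ZMod 2} {x : Q} (hx : x ∈ (gr i : Submodule ℂ Q)) :
    ∃ y ∈ (gr i : Submodule ℂ L), E.π y = x := by
  refine ⟨proj i (E.sect x), proj_mem _ _, ?_⟩
  rw [← proj_of_even E.π_even, E.π_sect, proj_of_mem hx, if_pos rfl]

theorem cocycle_mem (hM : ∀ (x : L) (m : M), act (E.π x) m = act x m)
    {φ : N →ₗ[ℂ] M} (hφ : φ ∈ ModHom z Q N M) : E.cocycle (M := M) z φ ∈ Z2 z Q M := by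
  have h := B2_le_Z2 z L M (Submodule.mem_map_of_mem (E.ext_mem z φ))
  refine ⟨fun i j x hx y hy => ?_, fun i j k x hx y hy w hw => ?_⟩
  · obtain ⟨x, hx', rfl⟩ := E.exists_lift hx
    obtain ⟨y, hy', rfl⟩ := E.exists_lift hy
    rw [E.cocycle_apply z hM hφ, E.cocycle_apply z hM hφ]
    exact h.1 i j x hx' y hy'
  · obtain ⟨x, hx', rfl⟩ := E.exists_lift hx
    obtain ⟨y, hy', rfl⟩ := E.exists_lift hy
    obtain ⟨w, hw', rfl⟩ := E.exists_lift hw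
    rw [← h.2 i j k x hx' y hy' w hw']
    simp only [d2, ← E.π_bracket, E.cocycle_apply z hM hφ, hM]

/-- The transgression `Hom_Q(N, M)_z → H²(Q, M)_z`: it sends `φ` to the class of the cocycle on
`Q` induced by `d¹ ψ`, where `ψ : L → M` is a linear extension of `φ ∘ q : K → M`.
It does not depend on the choice of `ψ`, see `transgression_eq`. -/
def transgression (hM : ∀ (x : L) (m : M), act (E.π x) m = act x m) :
    ModHom z Q N M →ₗ[ℂ] H2 z Q M :=
  Submodule.mkQ _ ∘ₗ ((E.cocycle z).domRestrict (ModHom z Q N M)).codRestrict (Z2 z Q M)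
    fun φ => E.cocycle_mem z hM φ.2

theorem transgression_eq (hM : ∀ (x : L) (m : M), act (E.π x) m = act x m)
    (φ : ModHom z Q N M) (ψ : L →ₗ[ℂ] M) (hψz : ψ ∈ HomDeg z L M)
    (hψ : ∀ k, ψ (E.ι k) = φ.1 (E.q k)) (c : Z2 z Q M)
    (hc : ∀ x y, c.1 (E.π x ⊗ₜ E.π y) = d1 z L M ψ (x ⊗ₜ y)) :
    E.transgression z hM φ = Submodule.Quotient.mk c := by
  refine (Submodule.Quotient.eq _).2 ?_
  set f : L →ₗ[ℂ] M := E.ext z φ.1 - ψ with hf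
  have hf0 : ∀ x, f (E.sect (E.π x)) = f x := by
    intro x
    obtain ⟨k, hk⟩ := E.exact (E.sect (E.π x) - x) (by rw [map_sub, E.π_sect, sub_self])
    rw [← sub_eq_zero, ← map_sub, ← hk, hf, LinearMap.sub_apply, E.ext_ι z φ.2.1, hψ, sub_self]
  have hfz : f ∈ HomDeg z L M := sub_mem (E.ext_mem z _) hψz
  refine ⟨f ∘ₗ E.sect, ?_, ?_⟩
  · intro i x hx
    obtain ⟨x, hx', rfl⟩ := E.exists_lift hx
    rw [LinearMap.comp_apply, hf0]
    exact hfz i x hx'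
  · refine TensorProduct.ext (hom_ext fun i x hx => hom_ext fun j y hy => ?_)
    obtain ⟨x, hx', rfl⟩ := E.exists_lift hx
    obtain ⟨y, hy', rfl⟩ := E.exists_lift hy
    change d1 z Q M (f ∘ₗ E.sect) (E.π x ⊗ₜ E.π y) =
      E.cocycle z φ.1 (E.π x ⊗ₜ E.π y) - c.1 (E.π x ⊗ₜ E.π y)
    rw [hc, E.cocycle_apply z hM φ.2, ← LinearMap.sub_apply, ← map_sub, ← hf,
      d1_apply z hx hy, d1_apply z hx' hy', ← E.π_bracket]
    simp only [LinearMap.comp_apply, hf0, hM]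

end SuperExtension

/-! ### Equivariant map superalgebras -/

namespace SuperSpace

/-- The super vector space `V ⊗ P` with `(V ⊗ P)_i = V_i ⊗ P`, for an (ungraded) vector
space `P`. -/
instance tensor (V P : Type*) [AddCommGroup V] [Module ℂ V] [SuperSpace V]
    [AddCommGroup P] [Module ℂ P] : SuperSpace (V ⊗[ℂ] P) where
  gr i := LinearMap.range ((gr i : Submodule ℂ V).subtype.rTensor P)
  isCompl := by
    have key : ∀ i j : ZMod 2, ∀ x ∈ LinearMap.range ((gr i : Submodule ℂ V).subtype.rTensor P),
        (proj j : V →ₗ[ℂ] V).rTensor P x = if j = i then x else 0 := by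
      rintro i j _ ⟨x, rfl⟩
      induction x with
      | zero => simp
      | add x y hx hy =>
        simp only [map_add, hx, hy]
        split_ifs <;> simp
      | tmul x p =>
        simp only [LinearMap.rTensor_tmul, Submodule.subtype_apply, proj_of_mem x.2]
        split_ifs <;> simp
    refine ⟨Submodule.disjoint_def.2 fun x h0 h1 => ?_, codisjoint_iff.2 (eq_top_iff.2 ?_)⟩
    · have a := key 0 0 x h0
      have b := key 1 0 x h1
      simp only [if_true] at a
      rw [← a, b]
      simp
    · rintro x -
      induction x with
      | zero => exact zero_mem _
      | add x y hx hy => exact add_mem hx hy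
      | tmul x p =>
        rw [← sum_proj x, TensorProduct.sum_tmul]
        refine sum_mem fun i _ => ?_
        rcases parity_cases i with rfl | rfl
        · exact Submodule.mem_sup_left ⟨⟨_, proj_mem 0 x⟩ ⊗ₜ p, rfl⟩
        · exact Submodule.mem_sup_right ⟨⟨_, proj_mem 1 x⟩ ⊗ₜ p, rfl⟩

/-- A graded subspace is a super vector space. -/
abbrev ofGraded {V : Type*} [AddCommGroup V] [Module ℂ V] [SuperSpace V] (W : Submodule ℂ V)
    (hW : IsGraded W) : SuperSpace W where
  gr i := (gr i : Submodule ℂ V).submoduleOf W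
  isCompl := by
    refine ⟨Submodule.disjoint_def.2 fun x h0 h1 => ?_, codisjoint_iff.2 (eq_top_iff.2 ?_)⟩
    · exact Subtype.ext (Submodule.disjoint_def.1 (isCompl (V := V)).disjoint x.1 h0 h1)
    · rintro x -
      have : x = ⟨proj 0 x.1, hW x.1 x.2 0⟩ + ⟨proj 1 x.1, hW x.1 x.2 1⟩ :=
        Subtype.ext (by
          have h := sum_proj x.1
          rw [show (Finset.univ : Finset (ZMod 2)) = {0, 1} from rfl,
            Finset.sum_pair (by decide)] at h
          exact h.symm)
      rw [this]
      exact Submodule.add_mem_sup (proj_mem 0 x.1) (proj_mem 1 x.1)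

end SuperSpace

section MapAct

variable (g : Type*) [AddCommGroup g] [Module ℂ g] [LieSuperalgebra g]
  (B : Type*) [CommRing B] [Algebra ℂ B]
  (P : Type*) [AddCommGroup P] [Module ℂ P] [Module B P] [IsScalarTower ℂ B P]

/-- The bilinear map `(g ⊗ B) × (g ⊗ P) → g ⊗ P`, `(x ⊗ b, y ⊗ p) ↦ [x, y] ⊗ b p`, for a
`B`-module `P`. -/
def mapAct : g ⊗[ℂ] B →ₗ[ℂ] g ⊗[ℂ] P →ₗ[ℂ] g ⊗[ℂ] P :=
  TensorProduct.map₂ bracket (Algebra.lsmul ℂ ℂ P : B →ₐ[ℂ] Module.End ℂ P).toLinearMap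

variable {g B P}

theorem mapAct_tmul (x y : g) (b : B) (p : P) :
    mapAct g B P (x ⊗ₜ b) (y ⊗ₜ p) = bracket x y ⊗ₜ (b • p) := rfl

theorem mapAct_mem {i j : ZMod 2} {x : g ⊗[ℂ] B} {y : g ⊗[ℂ] P}
    (hx : x ∈ (gr i : Submodule ℂ (g ⊗[ℂ] B))) (hy : y ∈ (gr j : Submodule ℂ (g ⊗[ℂ] P))) :
    mapAct g B P x y ∈ (gr (i + j) : Submodule ℂ (g ⊗[ℂ] P)) := by
  obtain ⟨x, rfl⟩ := hx
  obtain ⟨y, rfl⟩ := hy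
  induction x with
  | zero => simp
  | add x x' h h' => simp only [map_add, LinearMap.add_apply]; exact add_mem h h'
  | tmul x b =>
    induction y with
    | zero => simp
    | add y y' h h' => simp only [map_add]; exact add_mem h h'
    | tmul y p => exact ⟨⟨_, bracket_mem x.2 y.2⟩ ⊗ₜ (b • p), rfl⟩

theorem mapAct_skew {i j : ZMod 2} {x y : g ⊗[ℂ] B}
    (hx : x ∈ (gr i : Submodule ℂ (g ⊗[ℂ] B))) (hy : y ∈ (gr j : Submodule ℂ (g ⊗[ℂ] B))) :
    mapAct g B B x y = -(superSign i j • mapAct g B B y x) := by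
  obtain ⟨x, rfl⟩ := hx
  obtain ⟨y, rfl⟩ := hy
  induction x with
  | zero => simp
  | add x x' h h' => simp only [map_add, LinearMap.add_apply, h, h']; module
  | tmul x b =>
    induction y with
    | zero => simp
    | add y y' h h' => simp only [map_add, LinearMap.add_apply, h, h']; module
    | tmul y c =>
      simp only [LinearMap.rTensor_tmul, Submodule.subtype_apply, mapAct_tmul]
      rw [bracket_skew x.2 y.2, TensorProduct.neg_tmul, TensorProduct.smul_tmul', smul_eq_mul,
        smul_eq_mul, mul_comm]

theorem mapAct_mapAct {i j : ZMod 2} {x y : g ⊗[ℂ] B}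
    (hx : x ∈ (gr i : Submodule ℂ (g ⊗[ℂ] B))) (hy : y ∈ (gr j : Submodule ℂ (g ⊗[ℂ] B)))
    (w : g ⊗[ℂ] P) :
    mapAct g B P (mapAct g B B x y) w = mapAct g B P x (mapAct g B P y w)
      - superSign i j • mapAct g B P y (mapAct g B P x w) := by
  obtain ⟨x, rfl⟩ := hx
  obtain ⟨y, rfl⟩ := hy
  induction x with
  | zero => simp
  | add x x' h h' => simp only [map_add, LinearMap.add_apply, h, h']; module
  | tmul x b =>
    induction y with
    | zero => simp
    | add y y' h h' => simp only [map_add, LinearMap.add_apply, h, h']; module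
    | tmul y c =>
      induction w with
      | zero => simp
      | add w w' h h' => simp only [map_add, h, h']; module
      | tmul w p =>
        simp only [LinearMap.rTensor_tmul, Submodule.subtype_apply, mapAct_tmul]
        rw [jacobi x.2 y.2, TensorProduct.sub_tmul, TensorProduct.smul_tmul', smul_eq_mul,
          mul_smul, smul_comm c b]

/-- Functoriality of the action of `g ⊗ B` on `g ⊗ P`. -/
theorem map_mapAct {B' P' : Type*} [CommRing B'] [Algebra ℂ B'] [AddCommGroup P'] [Module ℂ P']
    [Module B' P'] [IsScalarTower ℂ B' P'] (T : g →ₗ[ℂ] g)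
    (hT : ∀ x y, T (bracket x y) = bracket (T x) (T y)) (φ : B →ₗ[ℂ] B') (f : P →ₗ[ℂ] P')
    (hf : ∀ b p, f (b • p) = φ b • f p) (x : g ⊗[ℂ] B) (y : g ⊗[ℂ] P) :
    TensorProduct.map T f (mapAct g B P x y)
      = mapAct g B' P' (TensorProduct.map T φ x) (TensorProduct.map T f y) := by
  induction x with
  | zero => simp
  | add x x' h h' => simp only [map_add, LinearMap.add_apply, h, h']
  | tmul x b =>
    induction y with
    | zero => simp
    | add y y' h h' => simp only [map_add, h, h']
    | tmul y p => simp [mapAct_tmul, hT, hf]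

/-- The map superalgebra `g ⊗ B`, with `[x ⊗ a, y ⊗ b] = [x, y] ⊗ a b`. -/
instance mapSuperalgebra : LieSuperalgebra (g ⊗[ℂ] B) where
  bracket := mapAct g B B
  bracket_mem := mapAct_mem
  bracket_skew := mapAct_skew
  jacobi := mapAct_mapAct

end MapAct

section Equivariant

variable {g : Type*} [AddCommGroup g] [Module ℂ g] [LieSuperalgebra g]
  {A : Type*} [CommRing A] [Algebra ℂ A] {Γ : Type*} [Group Γ]
  (ρ : Γ →* LieSuperalgebra.Aut g) (α : Γ →* (A ≃ₐ[ℂ] A))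

/-- The representation on `g` underlying an action by automorphisms. -/
def autRep : Representation ℂ Γ g where
  toFun γ := (ρ γ : g ≃ₗ[ℂ] g)
  map_one' := by ext; simp
  map_mul' _ _ := by ext; simp

/-- The representation on `A` underlying an action by algebra automorphisms. -/
def algRep : Representation ℂ Γ A where
  toFun γ := (α γ).toLinearMap
  map_one' := by ext; simp
  map_mul' _ _ := by ext; simp

variable {P : Type*} [AddCommGroup P] [Module ℂ P] (β : Representation ℂ Γ P)

/-- `(g ⊗ P)^Γ`, for the diagonal action of `Γ` on `g ⊗ P`. -/
def eqMap : Submodule ℂ (g ⊗[ℂ] P) := ((autRep ρ).tprod β).invariants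

theorem mem_eqMap {x : g ⊗[ℂ] P} :
    x ∈ eqMap ρ β ↔ ∀ γ, TensorProduct.map (autRep ρ γ) (β γ) x = x := Iff.rfl

theorem autRep_even (γ : Γ) : autRep ρ γ ∈ HomDeg 0 g g := fun i x hx => by
  rw [add_zero]
  exact ((ρ γ).2.1 i x).2 hx

theorem autRep_bracket (γ : Γ) (x y : g) :
    autRep ρ γ (bracket x y) = bracket (autRep ρ γ x) (autRep ρ γ y) := (ρ γ).2.2 x y

theorem map_even {P' : Type*} [AddCommGroup P'] [Module ℂ P'] {T : g →ₗ[ℂ] g}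
    (hT : T ∈ HomDeg 0 g g) (f : P →ₗ[ℂ] P') :
    TensorProduct.map T f ∈ HomDeg 0 (g ⊗[ℂ] P) (g ⊗[ℂ] P') := by
  rintro i _ ⟨x, rfl⟩
  induction x with
  | zero => simp
  | add x y hx hy => simp only [map_add]; exact add_mem hx hy
  | tmul x p => exact ⟨⟨_, hT i x x.2⟩ ⊗ₜ f p, rfl⟩

theorem eqMap_isGraded : IsGraded (eqMap ρ β) := fun x hx i γ => by
  change TensorProduct.map (autRep ρ γ) (β γ) _ = _
  rw [← proj_of_even (map_even (autRep_even ρ γ) (β γ)), (mem_eqMap ρ β).1 hx γ]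

instance : SuperSpace (eqMap ρ β) := SuperSpace.ofGraded _ (eqMap_isGraded ρ β)

theorem mem_gr_eqMap {i : ZMod 2} {x : eqMap ρ β} :
    x ∈ (gr i : Submodule ℂ (eqMap ρ β)) ↔ x.1 ∈ (gr i : Submodule ℂ (g ⊗[ℂ] P)) := Iff.rfl

theorem mapAct_mem_eqMap [Module A P] [IsScalarTower ℂ A P]
    (hβ : ∀ γ (a : A) (p : P), β γ (a • p) = α γ a • β γ p) {x : g ⊗[ℂ] A} {y : g ⊗[ℂ] P}
    (hx : x ∈ eqMap ρ (algRep α)) (hy : y ∈ eqMap ρ β) : mapAct g A P x y ∈ eqMap ρ β := by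
  intro γ
  change TensorProduct.map (autRep ρ γ) (β γ) _ = _
  rw [map_mapAct (autRep ρ γ) (autRep_bracket ρ γ) (algRep α γ) (β γ) (hβ γ),
    (mem_eqMap ρ _).1 hx γ, (mem_eqMap ρ β).1 hy γ]

/-- The equivariant map superalgebra `(g ⊗ A)^Γ`. -/
abbrev EquivariantMap : Type _ := eqMap ρ (algRep α)

/-- The action of `(g ⊗ A)^Γ` on `(g ⊗ P)^Γ` induced by that of `g ⊗ A` on `g ⊗ P`, for an
`A`-module `P` with a compatible action of `Γ`. -/
def eqAct [Module A P] [IsScalarTower ℂ A P]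
    (hβ : ∀ γ (a : A) (p : P), β γ (a • p) = α γ a • β γ p) :
    EquivariantMap ρ α →ₗ[ℂ] eqMap ρ β →ₗ[ℂ] eqMap ρ β :=
  LinearMap.mk₂ ℂ (fun x y => ⟨mapAct g A P x.1 y.1, mapAct_mem_eqMap ρ α β hβ x.2 y.2⟩)
    (fun _ _ _ => Subtype.ext (by simp)) (fun _ _ _ => Subtype.ext (by simp))
    (fun _ _ _ => Subtype.ext (by simp)) (fun _ _ _ => Subtype.ext (by simp))

/-- `(g ⊗ A)^Γ` is a Lie superalgebra, with the bracket of `g ⊗ A`. -/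
instance : LieSuperalgebra (EquivariantMap ρ α) where
  bracket := eqAct ρ α (algRep α) fun γ a p => map_mul (α γ) a p
  bracket_mem hx hy := mapAct_mem hx hy
  bracket_skew hx hy := Subtype.ext (mapAct_skew hx hy)
  jacobi hx hy w := Subtype.ext (mapAct_mapAct hx hy w.1)

/-- `(g ⊗ P)^Γ` is an `(g ⊗ A)^Γ`-module. -/
abbrev eqModule [Module A P] [IsScalarTower ℂ A P]
    (hβ : ∀ γ (a : A) (p : P), β γ (a • p) = α γ a • β γ p) :
    LieSuperModule (EquivariantMap ρ α) (eqMap ρ β) where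
  act := eqAct ρ α β hβ
  act_mem hx hy := mapAct_mem hx hy
  bracket_act hx hy w := Subtype.ext (mapAct_mapAct hx hy w.1)

variable {β} {P' : Type*} [AddCommGroup P'] [Module ℂ P'] {β' : Representation ℂ Γ P'}

/-- The map `(g ⊗ P)^Γ → (g ⊗ P')^Γ` induced by a `Γ`-equivariant linear map `P → P'`. -/
def eqMapMap (f : P →ₗ[ℂ] P') (hf : ∀ γ p, f (β γ p) = β' γ (f p)) :
    eqMap ρ β →ₗ[ℂ] eqMap ρ β' :=
  (f.lTensor g).restrict fun x hx γ => by
    change TensorProduct.map (autRep ρ γ) (β' γ) (TensorProduct.map LinearMap.id f x) =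
      TensorProduct.map LinearMap.id f x
    rw [← LinearMap.comp_apply, ← TensorProduct.map_comp]
    conv_rhs => rw [← (mem_eqMap ρ β).1 hx γ, ← LinearMap.comp_apply, ← TensorProduct.map_comp]
    congr 2
    ext p
    exact (hf γ p).symm

theorem eqMapMap_even (f : P →ₗ[ℂ] P') (hf : ∀ γ p, f (β γ p) = β' γ (f p)) :
    eqMapMap ρ f hf ∈ HomDeg 0 (eqMap ρ β) (eqMap ρ β') := fun i x hx =>
  map_even (T := LinearMap.id) (fun i x hx => by rwa [add_zero]) f i x.1 hx

theorem lTensor_equivariant (f : P →ₗ[ℂ] P') (hf : ∀ γ p, f (β γ p) = β' γ (f p)) (γ : Γ)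
    (x : g ⊗[ℂ] P) : f.lTensor g (TensorProduct.map (autRep ρ γ) (β γ) x)
      = TensorProduct.map (autRep ρ γ) (β' γ) (f.lTensor g x) := by
  induction x with
  | zero => simp
  | add x y hx hy => simp only [map_add, hx, hy]
  | tmul x p => simp [hf]

theorem eqMapMap_surjective [Finite Γ] (f : P →ₗ[ℂ] P') (hf : ∀ γ p, f (β γ p) = β' γ (f p))
    (hs : Function.Surjective f) : Function.Surjective (eqMapMap ρ f hf) := by
  rintro ⟨y, hy⟩
  obtain ⟨x, hx⟩ := LinearMap.lTensor_surjective g hs y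
  have := Fintype.ofFinite Γ
  have hc : (Fintype.card Γ : ℂ) ≠ 0 := by simp
  let σ := (autRep ρ).tprod β
  refine ⟨⟨(Fintype.card Γ : ℂ)⁻¹ • ∑ γ : Γ, σ γ x, fun δ => ?_⟩, Subtype.ext ?_⟩
  · change σ δ _ = _
    rw [map_smul, map_sum]
    congr 1
    rw [← Equiv.sum_comp (Equiv.mulLeft δ) (fun γ => σ γ x)]
    exact Finset.sum_congr rfl fun γ _ => (LinearMap.congr_fun (map_mul σ δ γ) x).symm
  · change f.lTensor g ((Fintype.card Γ : ℂ)⁻¹ • ∑ γ : Γ, σ γ x) = y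
    rw [map_smul, map_sum]
    have : ∀ γ : Γ, f.lTensor g (σ γ x) = y := fun γ => by
      change f.lTensor g (TensorProduct.map (autRep ρ γ) (β γ) x) = y
      rw [lTensor_equivariant ρ f hf, hx]
      exact hy γ
    simp only [this, Finset.sum_const, Finset.card_univ]
    rw [← Nat.cast_smul_eq_nsmul ℂ, smul_smul, inv_mul_cancel₀ hc, one_smul]

end Equivariant

/-! ### The extension attached to an invariant ideal -/

section Ideal

variable {g : Type*} [AddCommGroup g] [Module ℂ g] [LieSuperalgebra g]
  {A : Type*} [CommRing A] [Algebra ℂ A] {Γ : Type*} [Group Γ]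
  (ρ : Γ →* LieSuperalgebra.Aut g) (α : Γ →* (A ≃ₐ[ℂ] A))

/-- `Γ`-invariance of an ideal. -/
def IsInvariantIdeal (I : Ideal A) : Prop := ∀ γ, ∀ a ∈ I, α γ a ∈ I

variable {α} {I : Ideal A}

theorem IsInvariantIdeal.map_eq (hI : IsInvariantIdeal α I) (γ : Γ) : I = I.map (α γ : A →+* A) := by
  refine le_antisymm (fun a ha => ?_) (Ideal.map_le_iff_le_comap.2 fun a ha => hI γ a ha)
  have h : α γ (α γ⁻¹ a) = a := by
    rw [← AlgEquiv.mul_apply, ← map_mul, mul_inv_cancel, map_one, AlgEquiv.one_apply]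
  rw [← h]
  exact Ideal.mem_map_of_mem (α γ : A →+* A) (hI γ⁻¹ a ha)

variable (hI : IsInvariantIdeal α I)

/-- The action of `Γ` on `A/I`. -/
def quotAct : Γ →* ((A ⧸ I) ≃ₐ[ℂ] (A ⧸ I)) where
  toFun γ := Ideal.quotientEquivAlg I I (α γ) (hI.map_eq γ)
  map_one' := by
    ext a
    obtain ⟨a, rfl⟩ := Ideal.Quotient.mk_surjective a
    simp
  map_mul' γ δ := by
    ext a
    obtain ⟨a, rfl⟩ := Ideal.Quotient.mk_surjective a
    simp

/-- The action of `Γ` on `I`. -/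
def idealRep : Representation ℂ Γ I where
  toFun γ :=
    { toFun := fun a => ⟨α γ a, hI γ a a.2⟩
      map_add' := fun a b => Subtype.ext (by simp)
      map_smul' := fun c a => Subtype.ext (by simp) }
  map_one' := by ext; simp
  map_mul' _ _ := by ext; simp

/-- The action of `Γ` on `I/I²`. -/
def cotangentRep : Representation ℂ Γ I.Cotangent where
  toFun γ := I.mapCotangent I (α γ : A →ₐ[ℂ] A) (hI γ)
  map_one' := by
    ext a
    obtain ⟨a, rfl⟩ := I.toCotangent_surjective a
    simp
  map_mul' γ δ := by
    ext a
    obtain ⟨a, rfl⟩ := I.toCotangent_surjective a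
    change I.toCotangent ⟨α (γ * δ) a, _⟩ = I.toCotangent ⟨α γ (α δ a), _⟩
    exact congrArg I.toCotangent (Subtype.ext (by simp))

instance : IsScalarTower ℂ (A ⧸ I) I.Cotangent where
  smul_assoc c a p := by
    obtain ⟨a, rfl⟩ := Ideal.Quotient.mk_surjective a
    change (c • a) • p = c • (a • p)
    exact smul_assoc c a p

/-- `(g ⊗ A/I)^Γ`. -/
abbrev QuotEquivariantMap : Type _ := EquivariantMap ρ (quotAct hI)

/-- The module `(g ⊗ I/I²)^Γ` over `(g ⊗ A/I)^Γ`. -/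
abbrev EquivariantCotangent : Type _ := eqMap ρ (cotangentRep hI)

instance : LieSuperModule (QuotEquivariantMap ρ hI) (EquivariantCotangent ρ hI) :=
  eqModule ρ (quotAct hI) (cotangentRep hI) fun γ b p => by
    obtain ⟨a, rfl⟩ := Ideal.Quotient.mk_surjective b
    obtain ⟨p, rfl⟩ := I.toCotangent_surjective p
    change I.toCotangent ⟨α γ (a * p), _⟩ = I.toCotangent (α γ a • ⟨α γ p, _⟩)
    exact congrArg I.toCotangent (Subtype.ext (by simp))

/-- The projection `(g ⊗ A)^Γ → (g ⊗ A/I)^Γ`. -/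
def eqProj : EquivariantMap ρ α →ₗ[ℂ] QuotEquivariantMap ρ hI :=
  eqMapMap ρ (Ideal.Quotient.mkₐ ℂ I).toLinearMap fun _ _ => rfl

/-- The inclusion `(g ⊗ I)^Γ → (g ⊗ A)^Γ`. -/
def eqIncl : eqMap ρ (idealRep hI) →ₗ[ℂ] EquivariantMap ρ α :=
  eqMapMap ρ (I.subtype.restrictScalars ℂ) fun _ _ => rfl

/-- The projection `(g ⊗ I)^Γ → (g ⊗ I/I²)^Γ`. -/
def eqToCotangent : eqMap ρ (idealRep hI) →ₗ[ℂ] EquivariantCotangent ρ hI :=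
  eqMapMap ρ (I.toCotangent.restrictScalars ℂ) fun _ _ => rfl

theorem lTensor_incl_injective (V : Type*) [AddCommGroup V] [Module ℂ V] (I : Ideal A) :
    Function.Injective ((I.subtype.restrictScalars ℂ).lTensor V) :=
  Module.Flat.lTensor_preserves_injective_linearMap _ Subtype.val_injective

theorem lTensor_incl_exact (V : Type*) [AddCommGroup V] [Module ℂ V] (I : Ideal A) :
    Function.Exact ((I.subtype.restrictScalars ℂ).lTensor V)
      ((Ideal.Quotient.mkₐ ℂ I).toLinearMap.lTensor V) := by
  refine lTensor_exact V (fun a => ?_) Ideal.Quotient.mk_surjective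
  change Ideal.Quotient.mk I a = 0 ↔ _
  rw [Ideal.Quotient.eq_zero_iff_mem]
  exact ⟨fun h => ⟨⟨a, h⟩, rfl⟩, by rintro ⟨x, rfl⟩; exact x.2⟩

/-- The extension `0 → (g ⊗ I)^Γ → (g ⊗ A)^Γ → (g ⊗ A/I)^Γ → 0` with the projection
`(g ⊗ I)^Γ → (g ⊗ I/I²)^Γ`. -/
def idealExtension [Finite Γ] : SuperExtension (eqMap ρ (idealRep hI)) (EquivariantMap ρ α)
    (QuotEquivariantMap ρ hI) (EquivariantCotangent ρ hI) where
  ι := eqIncl ρ hI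
  π := eqProj ρ hI
  q := eqToCotangent ρ hI
  ι_even := eqMapMap_even ρ _ _
  π_even := eqMapMap_even ρ _ _
  q_even := eqMapMap_even ρ _ _
  ι_injective := fun x y h => Subtype.ext (lTensor_incl_injective g I (congrArg Subtype.val h))
  π_surjective := eqMapMap_surjective ρ _ _ Ideal.Quotient.mk_surjective
  π_ι := fun k => Subtype.ext ((lTensor_incl_exact g I).apply_apply_eq_zero k.1)
  exact := fun x hx => by
    obtain ⟨k, hk⟩ := (lTensor_incl_exact g I x.1).1 (congrArg Subtype.val hx)
    refine ⟨⟨k, fun γ => lTensor_incl_injective g I ?_⟩, Subtype.ext hk⟩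
    change (I.subtype.restrictScalars ℂ).lTensor g
      (TensorProduct.map (autRep ρ γ) (idealRep hI γ) k) = _
    rw [lTensor_equivariant ρ (β := idealRep hI) (β' := algRep α) (I.subtype.restrictScalars ℂ)
      (fun _ _ => rfl), hk]
    exact x.2 γ
  π_bracket := fun x y => Subtype.ext
    (map_mapAct LinearMap.id (fun _ _ => rfl) (Ideal.Quotient.mkₐ ℂ I).toLinearMap
      (Ideal.Quotient.mkₐ ℂ I).toLinearMap (fun a b => map_mul (Ideal.Quotient.mk I) a b) x.1 y.1)
  bracket_ι := fun x k => by
    refine ⟨eqAct ρ α (idealRep hI) (fun γ a p => Subtype.ext (map_mul (α γ) a p.1)) x k,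
      Subtype.ext ?_, Subtype.ext ?_⟩
    · refine (map_mapAct LinearMap.id (fun _ _ => rfl) (LinearMap.id : A →ₗ[ℂ] A)
        (I.subtype.restrictScalars ℂ) (fun a b => rfl) x.1 k.1).trans ?_
      rw [TensorProduct.map_id]
      rfl
    · exact map_mapAct LinearMap.id (fun _ _ => rfl) (Ideal.Quotient.mkₐ ℂ I).toLinearMap
        (I.toCotangent.restrictScalars ℂ) (fun a b => map_smul I.toCotangent a b) x.1 k.1

/-- The transgression
`t : Hom_{(g ⊗ A/I)^Γ}((g ⊗ I/I²)^Γ, M)_z → H²((g ⊗ A/I)^Γ, M)_z`. -/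
def idealTransgression [Finite Γ] {M : Type*} [AddCommGroup M] [Module ℂ M] [SuperSpace M]
    [LieSuperModule (EquivariantMap ρ α) M] [LieSuperModule (QuotEquivariantMap ρ hI) M]
    (hM : ∀ (x : EquivariantMap ρ α) (m : M), act (eqProj ρ hI x) m = act x m) (z : ZMod 2) :
    ModHom z (QuotEquivariantMap ρ hI) (EquivariantCotangent ρ hI) M →ₗ[ℂ]
      H2 z (QuotEquivariantMap ρ hI) M :=
  (idealExtension ρ hI).transgression z hM

end Ideal

end

noncomputable section

open SuperSpace LieSuperalgebra LieSuperModule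

/-! Put `L = (g ⊗ A)^Γ`, `K = (g ⊗ I)^Γ` and `Q = L/K = (g ⊗ A/I)^Γ`. If `K` acts trivially on `M`,
the low-degree inflation-restriction sequence `0 → H¹(Q, M) → H¹(L, M) → Hom_Q(K/[K,K], M) → H²(Q,
M)` is exact. Over a field it splits into `H¹(L, M) ≅ H¹(Q, M) ⊕ ker t`, one parity at a time
(`SuperExtension.nonempty_H1_equiv`). Two facts about map superalgebras remain: `(g ⊗ I/I²)^Γ` can
replace `K/[K,K]`, that is, the kernel of `K → (g ⊗ I/I²)^Γ` lies in `[K,K]`; and some `I` of finite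
codimension makes `K` act trivially.

Both come from one identity. Freeness on maximal ideals gives finitely many pairs `(aᵢ, bᵢ)` in `A`
with `∑ aᵢ γ(bᵢ) = 1` for `γ = 1` and `0` otherwise (`exists_galoisCoordinates`). With `tr w = ∑ γ
w`, which maps `g ⊗ P` onto `(g ⊗ P)^Γ`, this yields `tr([x,y] ⊗ ab) = ∑ [tr(x ⊗ a aᵢ), tr(y ⊗ bᵢ
b)]` (`sum_bracket_eqTrace`). So brackets of invariants are as plentiful as in the untwisted `g ⊗
A`, and `g = [g,g]` can be used as it would be there.

If `a, b ∈ I`, the identity puts `tr(x ⊗ ab)` in `[K,K]`, which settles the first fact. For the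
second, let `I` consist of the `a` such that every `tr(x ⊗ ab)` acts on `M` by zero. The annihilator
of `M` is an ideal, so by the identity it is enough that all `tr(x ⊗ a aᵢ)` act by zero. These
conditions define the kernel of one linear map from `A` to a finite-dimensional space. -/

/-- A surjection `r : Z → W` vanishing on `B`, whose kernel modulo `B` is the image of an injective
linear map `X → Z ⧸ B`, gives a decomposition of `Z ⧸ B`. -/
theorem nonempty_quotient_equiv_prod {X Z W : Type*} [AddCommGroup X] [Module ℂ X]
    [AddCommGroup Z] [Module ℂ Z] [AddCommGroup W] [Module ℂ W] {B : Submodule ℂ Z}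
    (i : X →ₗ[ℂ] Z ⧸ B) (hi : Function.Injective i) (r : Z →ₗ[ℂ] W) (hr : Function.Surjective r)
    (hB : B ≤ LinearMap.ker r)
    (h : ∀ f, r f = 0 ↔ ∃ y, i y = Submodule.Quotient.mk f) :
    Nonempty ((Z ⧸ B) ≃ₗ[ℂ] X × W) := by
  have hs : Function.Surjective (B.liftQ r hB) := fun w => by
    obtain ⟨f, rfl⟩ := hr w
    exact ⟨Submodule.Quotient.mk f, rfl⟩
  have hex : Function.Exact i (B.liftQ r hB) := fun x => by
    obtain ⟨f, rfl⟩ := Submodule.Quotient.mk_surjective _ x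
    exact h f
  -- A surjection of vector spaces splits, so the short exact sequence becomes a product.
  obtain ⟨l, hl⟩ := (B.liftQ r hB).exists_rightInverse_of_surjective (LinearMap.range_eq_top.2 hs)
  exact ⟨(hex.splitSurjectiveEquiv hi ⟨l, hl⟩).1⟩

/-! ### The inflation-restriction sequence in degree one -/

namespace SuperExtension

variable {K L Q N : Type*} [AddCommGroup K] [Module ℂ K] [SuperSpace K]
  [AddCommGroup L] [Module ℂ L] [LieSuperalgebra L]
  [AddCommGroup Q] [Module ℂ Q] [LieSuperalgebra Q]
  [AddCommGroup N] [Module ℂ N] [SuperSpace N] [LieSuperModule Q N]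
  (E : SuperExtension K L Q N)
  {M : Type*} [AddCommGroup M] [Module ℂ M] [SuperSpace M]

/-! ### Descent along the projection to the quotient. -/

theorem comp_π_mem_HomDeg_iff {z : ZMod 2} {f : Q →ₗ[ℂ] M} :
    f ∘ₗ E.π ∈ HomDeg z L M ↔ f ∈ HomDeg z Q M := by
  refine ⟨fun h i x hx => ?_, fun h i x hx => ?_⟩
  · obtain ⟨x, hx', rfl⟩ := E.exists_lift hx
    exact h i x hx'
  · have := E.π_even i x hx
    rw [add_zero] at this
    exact h i _ this

omit [SuperSpace M] in
/-- A linear map on `L` that vanishes on `K` factors through `Q`. -/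
theorem exists_comp_π {f : L →ₗ[ℂ] M} (hf : ∀ k, f (E.ι k) = 0) :
    ∃ h : Q →ₗ[ℂ] M, h ∘ₗ E.π = f := by
  refine ⟨f ∘ₗ E.sect, LinearMap.ext fun x => ?_⟩
  obtain ⟨k, hk⟩ := E.exact (E.sect (E.π x) - x) (by rw [map_sub, E.π_sect, sub_self])
  rw [← sub_eq_zero, LinearMap.comp_apply, LinearMap.comp_apply, ← map_sub, ← hk, hf]

variable [LieSuperModule L M]

/-- The `Q`-module structure on an `L`-module on which the ideal `K` acts trivially. -/
abbrev quotModule (hK : ∀ (k : K) (m : M), act (E.ι k) m = 0) : LieSuperModule Q M :=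
  -- The chosen linear section respects neither grading nor bracket. Since `K` acts by zero, it can
  -- be replaced under the action by any other lift, in particular a homogeneous one.
  have key : ∀ (x : L) (m : M), act (E.sect (E.π x)) m = act x m := fun x m => by
    obtain ⟨k, hk⟩ := E.exact (E.sect (E.π x) - x) (by rw [map_sub, E.π_sect, sub_self])
    rw [← sub_eq_zero, ← LinearMap.sub_apply, ← map_sub, ← hk, hK]
  { act := act (L := L) (M := M) ∘ₗ E.sect
    act_mem := fun hx hm => by
      obtain ⟨x, hx', rfl⟩ := E.exists_lift hx
      rw [LinearMap.comp_apply, key]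
      exact act_mem hx' hm
    bracket_act := fun hx hy m => by
      obtain ⟨x, hx', rfl⟩ := E.exists_lift hx
      obtain ⟨y, hy', rfl⟩ := E.exists_lift hy
      simp only [LinearMap.comp_apply, ← E.π_bracket, key]
      exact bracket_act hx' hy' m }

theorem quotModule_act (hK : ∀ (k : K) (m : M), act (E.ι k) m = 0) (x : L) (m : M) :
    (E.quotModule hK).act (E.π x) m = act x m := by
  change act (E.sect (E.π x)) m = act x m
  obtain ⟨k, hk⟩ := E.exact (E.sect (E.π x) - x) (by rw [map_sub, E.π_sect, sub_self])
  rw [← sub_eq_zero, ← LinearMap.sub_apply, ← map_sub, ← hk, hK]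

/-! ### Comparison of cochains on `Q` and `L`, and inflation. -/

variable [LieSuperModule Q M] (z : ZMod 2)
variable (hM : ∀ (x : L) (m : M), act (E.π x) m = act x m)

include hM

theorem d1_comp_π (f : Q →ₗ[ℂ] M) :
    d1 z L M (f ∘ₗ E.π) = d1 z Q M f ∘ₗ TensorProduct.map E.π E.π := by
  refine TensorProduct.ext (hom_ext fun i x hx => hom_ext fun j y hy => ?_)
  have hx' := E.π_even i x hx
  have hy' := E.π_even j y hy
  rw [add_zero] at hx' hy'
  change d1 z L M (f ∘ₗ E.π) (x ⊗ₜ y) = d1 z Q M f (E.π x ⊗ₜ E.π y)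
  rw [d1_apply z hx hy, d1_apply z hx' hy', ← E.π_bracket]
  simp only [LinearMap.comp_apply, hM]

theorem d0_comp_π (m : M) : d0 z Q M m ∘ₗ E.π = d0 z L M m := by
  refine hom_ext fun i x hx => ?_
  have hx' := E.π_even i x hx
  rw [add_zero] at hx'
  rw [LinearMap.comp_apply, d0_apply z hx, d0_apply z hx', hM]

/-- Since `π ⊗ π` is surjective, vanishing of `d¹` can be tested after pulling back to `L`. -/
theorem comp_π_mem_Z1_iff {f : Q →ₗ[ℂ] M} : f ∘ₗ E.π ∈ Z1 z L M ↔ f ∈ Z1 z Q M := by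
  refine and_congr E.comp_π_mem_HomDeg_iff ?_
  change d1 z L M (f ∘ₗ E.π) = 0 ↔ d1 z Q M f = 0
  rw [E.d1_comp_π z hM]
  refine ⟨fun h => ?_, fun h => by rw [h, LinearMap.zero_comp]⟩
  exact (LinearMap.cancel_right
    (TensorProduct.map_surjective E.π_surjective E.π_surjective)).1 (h.trans (by simp))

theorem comp_π_mem_B1_iff {f : Q →ₗ[ℂ] M} : f ∘ₗ E.π ∈ B1 z L M ↔ f ∈ B1 z Q M := by
  refine exists_congr fun m => and_congr_right fun _ => ?_
  rw [← E.d0_comp_π z hM, LinearMap.cancel_right E.π_surjective]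

/-- The inflation `H¹(Q, M)_z → H¹(L, M)_z`. -/
def inflation : H1 z Q M →ₗ[ℂ] H1 z L M :=
  Submodule.mapQ _ _
    ((E.π.lcomp ℂ M).restrict fun _ hf => (E.comp_π_mem_Z1_iff z hM).2 hf)
    fun _ hf => (E.comp_π_mem_B1_iff z hM).2 hf

theorem inflation_mk (f : Z1 z Q M) : E.inflation z hM (Submodule.Quotient.mk f)
    = Submodule.Quotient.mk ⟨f.1 ∘ₗ E.π, (E.comp_π_mem_Z1_iff z hM).2 f.2⟩ := rfl

/-- If a pulled-back cocycle is `d⁰ m` on `L`, it is already `d⁰ m` on `Q` for the same `m`, because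
`π` is surjective. -/
theorem inflation_injective : Function.Injective (E.inflation z hM) := by
  rw [injective_iff_map_eq_zero]
  intro x hx
  obtain ⟨f, rfl⟩ := Submodule.Quotient.mk_surjective _ x
  rw [inflation_mk, Submodule.Quotient.mk_eq_zero] at hx
  exact (Submodule.Quotient.mk_eq_zero _).2 ((E.comp_π_mem_B1_iff z hM).1 hx)

/-! ### Restriction to the ideal and the kernel of the transgression. -/

/-- `K` acts trivially on `M`. -/
theorem act_ι (k : K) (m : M) : act (E.ι k) m = 0 := by
  rw [← hM, E.π_ι, map_zero, LinearMap.zero_apply]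

/-- A cocycle vanishes on `[K, K]`. -/
theorem Z1_bracket_ι {f : L →ₗ[ℂ] M} (hf : f ∈ Z1 z L M) (k l : K) :
    f (bracket (E.ι k) (E.ι l)) = 0 := by
  have : ((bracket (L := L)).compl₁₂ E.ι E.ι).compr₂ f = 0 := by
    refine hom_ext fun i k hk => hom_ext fun j l hl => ?_
    have hk' := E.ι_even i k hk
    have hl' := E.ι_even j l hl
    rw [add_zero] at hk' hl'
    have h : d1 z L M f (E.ι k ⊗ₜ E.ι l) = 0 := by rw [LinearMap.mem_ker.1 hf.2]; rfl
    -- Both action terms of `d¹ f` vanish because `K` acts trivially, leaving only `f([k, l])`.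
    rw [d1_apply z hk' hl', E.act_ι hM, E.act_ι hM] at h
    simpa using h
  exact LinearMap.congr_fun₂ this k l

/-- A map `φ` on `N` through which a cocycle factors on `K` is a homomorphism of modules. -/
theorem mem_ModHom_of_Z1 (hq : Function.Surjective E.q) {f : L →ₗ[ℂ] M} (hf : f ∈ Z1 z L M)
    {φ : N →ₗ[ℂ] M} (hφ : ∀ k, φ (E.q k) = f (E.ι k)) : φ ∈ ModHom z Q N M := by
  refine ⟨fun i n hn => ?_, fun i x hx n => ?_⟩
  · obtain ⟨k, rfl⟩ := hq n
    have h := E.ι_even i _ (proj_mem i k)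
    rw [add_zero] at h
    -- The lift `k` of a homogeneous `n` need not be homogeneous, but `q` is even, so its component
    -- of the right parity is also a lift.
    have e : E.q k = E.q (proj i k) := by
      rw [← proj_of_even E.q_even, proj_of_mem hn, if_pos rfl]
    rw [e, hφ]
    exact hf.1 i _ h
  · obtain ⟨x, hx', rfl⟩ := E.exists_lift hx
    obtain ⟨k, rfl⟩ := hq n
    have : φ ∘ₗ act (E.π x) ∘ₗ E.q = superSign i z • act (E.π x) ∘ₗ φ ∘ₗ E.q := by
      refine hom_ext fun j k hk => ?_
      have hk' := E.ι_even j k hk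
      rw [add_zero] at hk'
      obtain ⟨k', e1, e2⟩ := E.bracket_ι x k
      -- With one argument in `K` the cocycle identity loses one action term and reads `f([x, k]) =
      -- ± x f(k)`, which is the module homomorphism condition.
      have h : d1 z L M f (x ⊗ₜ E.ι k) = 0 := by rw [LinearMap.mem_ker.1 hf.2]; rfl
      rw [d1_apply z hx' hk', E.act_ι hM, smul_zero, sub_zero, sub_eq_zero] at h
      simp only [LinearMap.comp_apply, LinearMap.smul_apply]
      rw [← e2, hφ, e1, hφ, hM, h]
    exact LinearMap.congr_fun this k

/-- The cocycle `f` is itself an admissible extension `ψ`, and `d¹ f = 0`; independence of the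
choice of `ψ` does the rest. -/
theorem transgression_eq_zero_of_Z1 {f : L →ₗ[ℂ] M} (hf : f ∈ Z1 z L M)
    (φ : ModHom z Q N M) (hφ : ∀ k, φ.1 (E.q k) = f (E.ι k)) : E.transgression z hM φ = 0 := by
  rw [E.transgression_eq z hM φ f hf.1 (fun k => (hφ k).symm) 0 fun x y => by
    rw [LinearMap.mem_ker.1 hf.2]; rfl]
  rfl

/-- A homomorphism in the kernel of the transgression extends to a cocycle on `L`. -/
theorem exists_Z1_of_transgression_eq_zero (φ : ModHom z Q N M)
    (hφ : E.transgression z hM φ = 0) :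
    ∃ f ∈ Z1 z L M, ∀ k, φ.1 (E.q k) = f (E.ι k) := by
  obtain ⟨h, hh, e⟩ := (Submodule.Quotient.mk_eq_zero _).1 hφ
  change d1 z Q M h = E.cocycle z φ.1 at e
  -- Vanishing of the class says that the induced cocycle on `Q` is `d¹ h`. Subtracting the pullback
  -- of `h` removes the defect without changing the values on `K`.
  refine ⟨E.ext z φ.1 - h ∘ₗ E.π,
    ⟨sub_mem (E.ext_mem z _) (E.comp_π_mem_HomDeg_iff.2 hh), LinearMap.mem_ker.2 ?_⟩,
    fun k => ?_⟩
  · rw [map_sub, sub_eq_zero, E.d1_comp_π z hM, e]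
    refine TensorProduct.ext' fun x y => ?_
    rw [← E.cocycle_apply z hM φ.2]
    rfl
  · rw [LinearMap.sub_apply, E.ext_ι z φ.2.1, LinearMap.comp_apply, E.π_ι, map_zero, sub_zero]

/-- If `q` is surjective with kernel contained in `[K, K]`, a cocycle on `L` restricted to `K`
factors through `N`, and this gives a linear map to the kernel of the transgression. -/
theorem exists_Z1_restriction (hq : Function.Surjective E.q)
    (hker : ∀ k, E.q k = 0 →
      E.ι k ∈ Submodule.span ℂ (Set.range fun p : K × K => bracket (E.ι p.1) (E.ι p.2))) :
    ∃ r : Z1 z L M →ₗ[ℂ] LinearMap.ker (E.transgression z hM),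
      ∀ f k, (r f).1.1 (E.q k) = f.1 (E.ι k) := by
  obtain ⟨s, hs⟩ := E.q.exists_rightInverse_of_surjective (LinearMap.range_eq_top.2 hq)
  have hs' : ∀ n, E.q (s n) = n := LinearMap.congr_fun hs
  -- The section `s` is merely linear. It does no harm: `s (q k) - k` lies in `ker q`, hence in the
  -- span of brackets from `K`, where every cocycle vanishes.
  have key : ∀ f ∈ Z1 z L M, ∀ k, f (E.ι (s (E.q k))) = f (E.ι k) := by
    intro f hf k
    rw [← sub_eq_zero, ← map_sub, ← map_sub]
    have h := hker (s (E.q k) - k) (by rw [map_sub, hs', sub_self])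
    refine (Submodule.span_le (p := LinearMap.ker f)).2 ?_ h
    rintro _ ⟨p, rfl⟩
    exact E.Z1_bracket_ι z hM hf p.1 p.2
  have mem : ∀ f : Z1 z L M, f.1 ∘ₗ E.ι ∘ₗ s ∈ ModHom z Q N M := fun f =>
    E.mem_ModHom_of_Z1 z hM hq f.2 (key f.1 f.2)
  exact ⟨LinearMap.codRestrict _
      (LinearMap.codRestrict _ ((E.ι ∘ₗ s).lcomp ℂ M ∘ₗ (Z1 z L M).subtype) mem)
      fun f => E.transgression_eq_zero_of_Z1 z hM f.2 ⟨_, mem f⟩ (key f.1 f.2),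
    fun f k => key f.1 f.2 k⟩

/-- Exactness at `H¹(L, M)`. Coboundaries vanish on `K`, so vanishing there depends only on the
class, and a cocycle that vanishes on `K` descends to `Q`. -/
theorem exists_inflation_iff (f : Z1 z L M) :
    (∃ y, E.inflation z hM y = Submodule.Quotient.mk f) ↔ ∀ k, f.1 (E.ι k) = 0 := by
  constructor
  · rintro ⟨y, hy⟩ k
    obtain ⟨u, rfl⟩ := Submodule.Quotient.mk_surjective _ y
    rw [inflation_mk, Submodule.Quotient.eq] at hy
    obtain ⟨m, -, hm⟩ := hy
    have h := LinearMap.congr_fun hm (E.ι k)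
    rw [← E.d0_comp_π z hM] at h
    change d0 z Q M m (E.π (E.ι k)) = u.1 (E.π (E.ι k)) - f.1 (E.ι k) at h
    rw [E.π_ι, map_zero, map_zero, zero_sub] at h
    rw [← neg_eq_zero, ← h]
  · intro h0
    obtain ⟨u, hu⟩ := E.exists_comp_π h0
    exact ⟨Submodule.Quotient.mk ⟨u, (E.comp_π_mem_Z1_iff z hM).1 (hu ▸ f.2)⟩,
      congrArg Submodule.Quotient.mk (Subtype.ext hu)⟩

theorem B1_ι {f : L →ₗ[ℂ] M} (hf : f ∈ B1 z L M) (k : K) : f (E.ι k) = 0 := by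
  obtain ⟨m, -, rfl⟩ := hf
  rw [← E.d0_comp_π z hM, LinearMap.comp_apply, E.π_ι, map_zero]

/-- If `q` is surjective with kernel contained in `[K, K]`, then
`H¹(L, M)_z ≅ H¹(Q, M)_z ⊕ ker t`. -/
theorem nonempty_H1_equiv (hq : Function.Surjective E.q)
    (hker : ∀ k, E.q k = 0 →
      E.ι k ∈ Submodule.span ℂ (Set.range fun p : K × K => bracket (E.ι p.1) (E.ι p.2))) :
    Nonempty (H1 z L M ≃ₗ[ℂ] H1 z Q M × LinearMap.ker (E.transgression z hM)) := by
  obtain ⟨r, hr⟩ := E.exists_Z1_restriction z hM hq hker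
  have hr0 : ∀ f, r f = 0 ↔ ∀ k, f.1 (E.ι k) = 0 := fun f => by
    simp only [← hr]
    refine ⟨fun h k => by rw [h]; rfl, fun h => Subtype.ext (Subtype.ext ?_)⟩
    exact (LinearMap.cancel_right hq).1 (LinearMap.ext h)
  have hsurj : Function.Surjective r := fun φ => by
    obtain ⟨f, hf, e⟩ := E.exists_Z1_of_transgression_eq_zero z hM φ.1 φ.2
    refine ⟨⟨f, hf⟩, Subtype.ext (Subtype.ext ?_)⟩
    exact (LinearMap.cancel_right hq).1 (LinearMap.ext fun k => (hr ⟨f, hf⟩ k).trans (e k).symm)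
  exact nonempty_quotient_equiv_prod (B := (B1 z L M).submoduleOf (Z1 z L M))
    (W := LinearMap.ker (E.transgression z hM))
    (E.inflation z hM) (E.inflation_injective z hM) r hsurj
    (fun f hf => (hr0 f).2 (E.B1_ι z hM hf))
    fun f => (hr0 f).trans (E.exists_inflation_iff z hM f).symm

end SuperExtension

/-! ### Perfectness of simple Lie superalgebras -/

namespace LieSuperalgebra

/-- The span of all brackets is a graded ideal, and it is nonzero since the bracket is. -/
theorem IsSimple.span_bracket_eq_top {g : Type*} [AddCommGroup g] [Module ℂ g]
    [LieSuperalgebra g] (hg : IsSimple g) :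
    Submodule.span ℂ (Set.range fun p : g × g => bracket p.1 p.2) = ⊤ := by
  have mem : ∀ x y : g,
      bracket x y ∈ Submodule.span ℂ (Set.range fun p : g × g => bracket p.1 p.2) :=
    fun x y => Submodule.subset_span ⟨(x, y), rfl⟩
  refine (hg.2 _ (fun x hx i => ?_) fun x y _ => mem x y).resolve_left fun h => ?_
  · refine (Submodule.span_le (p := Submodule.comap (proj i)
      (Submodule.span ℂ (Set.range fun p : g × g => bracket p.1 p.2)))).2 ?_ hx
    rintro _ ⟨⟨x, y⟩, rfl⟩
    change proj i (bracket x y) ∈ Submodule.span ℂ (Set.range fun p : g × g => bracket p.1 p.2)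
    rw [← sum_proj x, ← sum_proj y]
    simp only [map_sum, LinearMap.sum_apply]
    refine sum_mem fun j _ => sum_mem fun k _ => ?_
    rw [proj_of_mem (bracket_mem (proj_mem _ _) (proj_mem _ _))]
    split_ifs
    · exact mem _ _
    · exact zero_mem _
  · obtain ⟨x, y, hxy⟩ := hg.1
    exact hxy ((Submodule.mem_bot ℂ).1 (h ▸ mem x y))

end LieSuperalgebra

/-! ### Annihilators of graded modules. -/

namespace LieSuperModule

variable {L : Type*} [AddCommGroup L] [Module ℂ L] [LieSuperalgebra L]
  {M : Type*} [AddCommGroup M] [Module ℂ M] [SuperSpace M] [LieSuperModule L M]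

/-- On a homogeneous `m`, the two components of `x` send `m` to different parities, so they cannot
cancel in `x m = 0`. -/
theorem act_proj_eq_zero {x : L} (hx : act (M := M) x = 0) (i : ZMod 2) :
    act (M := M) (proj i x) = 0 := by
  refine hom_ext fun j m hm => ?_
  have h : proj (i + j) (act x m) = act (proj i x) m := by
    nth_rw 1 [← sum_proj x]
    rw [map_sum, LinearMap.sum_apply, map_sum, Finset.sum_eq_single i]
    · rw [proj_of_mem (act_mem (proj_mem i x) hm), if_pos rfl]
    · intro k _ hk
      rw [proj_of_mem (act_mem (proj_mem k x) hm), if_neg fun h => hk (add_right_cancel h).symm]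
    · simp
  rw [← h, hx, LinearMap.zero_apply, map_zero]

/-- The annihilator of a module is an ideal. -/
theorem act_bracket_eq_zero {x : L} (hx : act (M := M) x = 0) (y : L) :
    act (M := M) (bracket x y) = 0 := by
  rw [← sum_proj x, ← sum_proj y]
  simp only [map_sum, LinearMap.sum_apply]
  refine Finset.sum_eq_zero fun i _ => Finset.sum_eq_zero fun j _ => LinearMap.ext fun m => ?_
  rw [bracket_act (proj_mem _ _) (proj_mem _ _), act_proj_eq_zero hx]
  simp

end LieSuperModule

/-! ### Galois coordinates of a free action -/

section Galois

variable {A : Type*} [CommRing A] [Algebra ℂ A] {Γ : Type*} [Group Γ] {α : Γ →* (A ≃ₐ[ℂ] A)}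

/-- A maximal ideal containing every `a - γ(a)` would be fixed by `γ`, since `γ` acts trivially
modulo it. -/
theorem span_sub_eq_top_of_free
    (hfree : ∀ (γ : Γ) (m : Ideal A), m.IsMaximal → m.map (α γ : A →+* A) = m → γ = 1)
    {γ : Γ} (hγ : γ ≠ 1) : Ideal.span (Set.range fun a => a - α γ a) = ⊤ := by
  by_contra h
  obtain ⟨m, hm, hle⟩ := Ideal.exists_le_maximal _ h
  have hsub : ∀ a, a - α γ a ∈ m := fun a => hle (Ideal.subset_span ⟨a, rfl⟩)
  refine hγ (hfree γ m hm (le_antisymm (Ideal.map_le_iff_le_comap.2 fun a ha => ?_) fun b hb => ?_))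
  · have := sub_mem ha (hsub a)
    rwa [sub_sub_cancel] at this
  · obtain ⟨c, rfl⟩ := (α γ).surjective b
    refine Ideal.mem_map_of_mem (α γ : A →+* A) ?_
    have := add_mem (hsub c) hb
    rwa [sub_add_cancel] at this

/-- The algebra homomorphism `a ⊗ b ↦ a γ(b)`. -/
def twistedMul (α : Γ →* (A ≃ₐ[ℂ] A)) (γ : Γ) : A ⊗[ℂ] A →ₐ[ℂ] A :=
  Algebra.TensorProduct.productMap (AlgHom.id ℂ A) (α γ : A →ₐ[ℂ] A)

theorem twistedMul_tmul (γ : Γ) (a b : A) : twistedMul α γ (a ⊗ₜ b) = a * α γ b := by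
  simp [twistedMul]

/-- The values at `1` of elements killed by the twist at `γ` form an ideal of `A` containing every
`a - γ(a)`, hence `1`. -/
theorem exists_separating
    (hfree : ∀ (γ : Γ) (m : Ideal A), m.IsMaximal → m.map (α γ : A →+* A) = m → γ = 1)
    {γ : Γ} (hγ : γ ≠ 1) : ∃ e : A ⊗[ℂ] A, twistedMul α 1 e = 1 ∧ twistedMul α γ e = 0 := by
  have key : ∀ t ∈ Ideal.span (Set.range fun a => a - α γ a),
      ∃ e : A ⊗[ℂ] A, twistedMul α 1 e = t ∧ twistedMul α γ e = 0 := by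
    intro t ht
    induction ht using Submodule.span_induction with
    | mem t ht =>
      obtain ⟨a, rfl⟩ := ht
      -- Twisting by `1` gives `a - γ(a)`; twisting by `γ` gives `γ(a) - γ(a) = 0`.
      exact ⟨1 ⊗ₜ a - α γ a ⊗ₜ 1, by simp [twistedMul_tmul], by simp [twistedMul_tmul]⟩
    | zero => exact ⟨0, map_zero _, map_zero _⟩
    | add s t _ _ hs ht =>
      obtain ⟨e, h1, h2⟩ := hs
      obtain ⟨f, h3, h4⟩ := ht
      exact ⟨e + f, by rw [map_add, h1, h3], by rw [map_add, h2, h4, add_zero]⟩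
    | smul b t _ ht =>
      obtain ⟨e, h1, h2⟩ := ht
      exact ⟨(b ⊗ₜ 1) * e, by rw [map_mul, h1, twistedMul_tmul]; simp,
        by rw [map_mul, h2, mul_zero]⟩
  exact key 1 (by rw [span_sub_eq_top_of_free hfree hγ]; trivial)

open scoped Classical in
-- The maps `twistedMul` are multiplicative, so the product of the separating elements over all `γ ≠
-- 1` takes the value `1` at the identity and `0` elsewhere. Its expansion into pure tensors gives
-- the pairs.
theorem exists_galoisCoordinates [Finite Γ]
    (hfree : ∀ (γ : Γ) (m : Ideal A), m.IsMaximal → m.map (α γ : A →+* A) = m → γ = 1) :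
    ∃ S : Finset (A × A), ∀ γ, ∑ p ∈ S, p.1 * α γ p.2 = if γ = 1 then 1 else 0 := by
  have := Fintype.ofFinite Γ
  choose e he1 he2 using fun γ : {γ : Γ // γ ≠ 1} => exists_separating hfree γ.2
  obtain ⟨S, hS⟩ := TensorProduct.exists_finset (∏ γ, e γ)
  refine ⟨S, fun γ => ?_⟩
  have h : ∑ p ∈ S, p.1 * α γ p.2 = twistedMul α γ (∏ γ, e γ) := by
    rw [hS, map_sum]
    simp only [twistedMul_tmul]
  rw [h, map_prod]
  split_ifs with hγ
  · subst hγ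
    exact Finset.prod_eq_one fun δ _ => he1 δ
  · exact Finset.prod_eq_zero (Finset.mem_univ ⟨γ, hγ⟩) (he2 ⟨γ, hγ⟩)

end Galois

/-! ### The trace `g ⊗ P → (g ⊗ P)^Γ` -/

section Trace

variable {g : Type*} [AddCommGroup g] [Module ℂ g] [LieSuperalgebra g]
  {A : Type*} [CommRing A] [Algebra ℂ A] {Γ : Type*} [Group Γ] [Fintype Γ]
  (ρ : Γ →* LieSuperalgebra.Aut g) (α : Γ →* (A ≃ₐ[ℂ] A))
  {P : Type*} [AddCommGroup P] [Module ℂ P] (β : Representation ℂ Γ P)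

/-- The trace `w ↦ ∑ γ, γ w`. -/
def eqTrace : g ⊗[ℂ] P →ₗ[ℂ] eqMap ρ β :=
  (∑ γ : Γ, TensorProduct.map (autRep ρ γ) (β γ)).codRestrict _ fun w δ => by
    change ((autRep ρ).tprod β) δ ((∑ γ : Γ, ((autRep ρ).tprod β) γ) w) =
      (∑ γ : Γ, ((autRep ρ).tprod β) γ) w
    rw [LinearMap.sum_apply, map_sum,
      ← Equiv.sum_comp (Equiv.mulLeft δ) (fun γ => ((autRep ρ).tprod β) γ w)]
    exact Finset.sum_congr rfl fun γ _ =>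
      (LinearMap.congr_fun (map_mul ((autRep ρ).tprod β) δ γ) w).symm

theorem eqTrace_coe (w : g ⊗[ℂ] P) :
    (eqTrace ρ β w).1 = ∑ γ : Γ, TensorProduct.map (autRep ρ γ) (β γ) w := by
  change (∑ γ : Γ, TensorProduct.map (autRep ρ γ) (β γ)) w = _
  rw [LinearMap.sum_apply]

theorem eqTrace_of_mem (w : eqMap ρ β) : eqTrace ρ β w.1 = (Fintype.card Γ : ℂ) • w := by
  refine Subtype.ext ?_
  rw [eqTrace_coe, Finset.sum_congr rfl fun γ _ => (mem_eqMap ρ β).1 w.2 γ]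
  simp [Nat.cast_smul_eq_nsmul]

/-- Allows statements about invariants to be checked on traces of pure tensors. -/
theorem eqTrace_surjective_apply (w : eqMap ρ β) :
    eqTrace ρ β ((Fintype.card Γ : ℂ)⁻¹ • w.1) = w := by
  rw [map_smul, eqTrace_of_mem, smul_smul, inv_mul_cancel₀ (by simp), one_smul]

theorem eqTrace_act (δ : Γ) (w : g ⊗[ℂ] P) :
    eqTrace ρ β (TensorProduct.map (autRep ρ δ) (β δ) w) = eqTrace ρ β w := by
  refine Subtype.ext ?_
  rw [eqTrace_coe, eqTrace_coe,
    ← Equiv.sum_comp (Equiv.mulRight δ) (fun γ => TensorProduct.map (autRep ρ γ) (β γ) w)]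
  exact Finset.sum_congr rfl fun γ _ =>
    (LinearMap.congr_fun (map_mul ((autRep ρ).tprod β) γ δ) w).symm

variable {β} {P' : Type*} [AddCommGroup P'] [Module ℂ P'] {β' : Representation ℂ Γ P'} in
theorem eqMapMap_eqTrace (f : P →ₗ[ℂ] P') (hf : ∀ γ p, f (β γ p) = β' γ (f p))
    (w : g ⊗[ℂ] P) : eqMapMap ρ f hf (eqTrace ρ β w) = eqTrace ρ β' (f.lTensor g w) := by
  refine Subtype.ext ?_
  change f.lTensor g (eqTrace ρ β w).1 = _
  rw [eqTrace_coe, eqTrace_coe, map_sum]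
  exact Finset.sum_congr rfl fun γ _ => lTensor_equivariant ρ f hf γ w

theorem eqIncl_eqTrace {α : Γ →* (A ≃ₐ[ℂ] A)} {I : Ideal A} (hI : IsInvariantIdeal α I)
    (w : g ⊗[ℂ] I) : eqIncl ρ hI (eqTrace ρ (idealRep hI) w)
      = eqTrace ρ (algRep α) ((I.subtype.restrictScalars ℂ).lTensor g w) :=
  eqMapMap_eqTrace ρ (I.subtype.restrictScalars ℂ) (fun _ _ => rfl) w

variable {ρ α}

/-- Galois coordinates express the trace of `[x, y] ⊗ ab` by brackets of traces. -/
theorem sum_bracket_eqTrace {S : Finset (A × A)}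
    (hS : ∀ γ, γ ≠ 1 → ∑ p ∈ S, p.1 * α γ p.2 = 0) (hS1 : ∑ p ∈ S, p.1 * p.2 = 1)
    (x y : g) (a b : A) :
    ∑ p ∈ S, bracket (eqTrace ρ (algRep α) (x ⊗ₜ (a * p.1)))
      (eqTrace ρ (algRep α) (y ⊗ₜ (p.2 * b))) = eqTrace ρ (algRep α) (bracket x y ⊗ₜ (a * b)) := by
  classical
  -- Orthogonality for two group elements: apply `γ` to the relation for `γ⁻¹δ`. It collapses the
  -- double sum below to its diagonal.
  have hS' : ∀ γ δ, ∑ p ∈ S, α γ p.1 * α δ p.2 = if γ = δ then 1 else 0 := by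
    intro γ δ
    have : ∑ p ∈ S, α γ p.1 * α δ p.2 = α γ (∑ p ∈ S, p.1 * α (γ⁻¹ * δ) p.2) := by
      rw [map_sum]
      refine Finset.sum_congr rfl fun p _ => ?_
      rw [map_mul, ← AlgEquiv.mul_apply, ← map_mul, mul_inv_cancel_left]
    rw [this]
    split_ifs with h
    · subst h
      simp [hS1]
    · rw [hS _ fun h' => h (inv_mul_eq_one.1 h'), map_zero]
  refine Subtype.ext ?_
  have e : ∀ p : A × A, (bracket (eqTrace ρ (algRep α) (x ⊗ₜ (a * p.1)))
      (eqTrace ρ (algRep α) (y ⊗ₜ (p.2 * b)))).1 = ∑ γ : Γ, ∑ δ : Γ,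
        bracket (autRep ρ γ x) (autRep ρ δ y) ⊗ₜ[ℂ] ((α γ a * α δ b) * (α γ p.1 * α δ p.2)) := by
    intro p
    change mapAct g A A (eqTrace ρ (algRep α) (x ⊗ₜ (a * p.1))).1
      (eqTrace ρ (algRep α) (y ⊗ₜ (p.2 * b))).1 = _
    rw [eqTrace_coe, eqTrace_coe]
    simp only [map_sum, LinearMap.sum_apply, TensorProduct.map_tmul, mapAct_tmul]
    rw [Finset.sum_comm]
    refine Finset.sum_congr rfl fun γ _ => Finset.sum_congr rfl fun δ _ => ?_
    congr 1
    change α γ (a * p.1) * α δ (p.2 * b) = _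
    rw [map_mul, map_mul]
    ring
  rw [AddSubmonoidClass.coe_finsetSum, Finset.sum_congr rfl fun p _ => e p, Finset.sum_comm,
    eqTrace_coe]
  refine Finset.sum_congr rfl fun γ _ => ?_
  rw [Finset.sum_comm, Finset.sum_eq_single γ]
  · rw [← TensorProduct.tmul_sum, ← Finset.mul_sum, hS', if_pos rfl, mul_one,
      TensorProduct.map_tmul, autRep_bracket, ← map_mul]
    rfl
  · intro δ _ hδ
    rw [← TensorProduct.tmul_sum, ← Finset.mul_sum, hS', if_neg hδ.symm, mul_zero,
      TensorProduct.tmul_zero]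
  · simp

end Trace

/-! ### Annihilating ideals and commutators -/

section Main

variable {g : Type*} [AddCommGroup g] [Module ℂ g] [LieSuperalgebra g]
  {A : Type*} [CommRing A] [Algebra ℂ A] {Γ : Type*} [Group Γ]
  {ρ : Γ →* LieSuperalgebra.Aut g} {α : Γ →* (A ≃ₐ[ℂ] A)}

/-- A finite-dimensional `(g ⊗ A)^Γ`-module is annihilated by `(g ⊗ I)^Γ` for some
`Γ`-invariant ideal `I` of finite codimension. -/
theorem exists_invariantIdeal_act_eq_zero [FiniteDimensional ℂ g] [Finite Γ]
    (hg : LieSuperalgebra.IsSimple g)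
    (hfree : ∀ (γ : Γ) (m : Ideal A), m.IsMaximal → m.map (α γ : A →+* A) = m → γ = 1)
    (M : Type*) [AddCommGroup M] [Module ℂ M] [SuperSpace M] [FiniteDimensional ℂ M]
    [LieSuperModule (EquivariantMap ρ α) M] :
    ∃ (I : Ideal A) (hI : IsInvariantIdeal α I), FiniteDimensional ℂ (A ⧸ I) ∧
      ∀ (k : eqMap ρ (idealRep hI)) (m : M), act (eqIncl ρ hI k) m = 0 := by
  classical
  have := Fintype.ofFinite Γ
  obtain ⟨S, hS⟩ := exists_galoisCoordinates hfree
  have hS0 : ∀ γ, γ ≠ 1 → ∑ p ∈ S, p.1 * α γ p.2 = 0 := fun γ hγ => by rw [hS, if_neg hγ]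
  have hS1 : ∑ p ∈ S, p.1 * p.2 = 1 := by simpa using hS 1
  let T : g →ₗ[ℂ] A →ₗ[ℂ] M →ₗ[ℂ] M :=
    (TensorProduct.mk ℂ g A).compr₂ (act (L := EquivariantMap ρ α) ∘ₗ eqTrace ρ (algRep α))
  have hT : ∀ x a, T x a = act (eqTrace ρ (algRep α) (x ⊗ₜ a)) := fun _ _ => rfl
  -- The factor `b` makes this the largest ideal all of whose elements `a` have `tr(x ⊗ a)` acting
  -- by zero for every `x`.
  let I : Ideal A :=
    { carrier := {a | ∀ x b, T x (a * b) = 0}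
      add_mem' := fun ha hb x c => by rw [add_mul, map_add, ha, hb, add_zero]
      zero_mem' := fun x b => by rw [zero_mul, map_zero]
      smul_mem' := fun c a ha x b => by
        rw [smul_eq_mul, mul_comm c, mul_assoc]
        exact ha x _ }
  have hI : IsInvariantIdeal α I := fun γ a ha x b => by
    -- The trace does not change when its argument is moved by `γ`, so `γ` can be shifted from `a`
    -- onto `x` and `b`.
    have e : x ⊗ₜ[ℂ] (α γ a * b) = TensorProduct.map (autRep ρ γ) (algRep α γ)
        (autRep ρ γ⁻¹ x ⊗ₜ (a * α γ⁻¹ b)) := by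
      rw [TensorProduct.map_tmul, ← Module.End.mul_apply, ← map_mul, mul_inv_cancel, map_one]
      change _ = x ⊗ₜ[ℂ] α γ (a * α γ⁻¹ b)
      rw [map_mul, ← AlgEquiv.mul_apply, ← map_mul, mul_inv_cancel, map_one, AlgEquiv.one_apply]
    rw [hT, e, eqTrace_act, ← hT]
    exact ha _ _
  -- In the bracket formula `b` enters only the second factor. Killing the first factors therefore
  -- handles all `b` with finitely many coordinates.
  have hker : ∀ a, (∀ p ∈ S, ∀ x, T x (a * p.1) = 0) → a ∈ I := by
    intro a ha x b
    have hx : x ∈ Submodule.span ℂ (Set.range fun p : g × g => bracket p.1 p.2) := by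
      rw [hg.span_bracket_eq_top]
      trivial
    refine (Submodule.span_le (p := LinearMap.ker (T.flip (a * b)))).2 ?_ hx
    rintro _ ⟨⟨x, y⟩, rfl⟩
    change act (eqTrace ρ (algRep α) (bracket x y ⊗ₜ (a * b))) = 0
    rw [← sum_bracket_eqTrace hS0 hS1, map_sum]
    refine Finset.sum_eq_zero fun p hp => ?_
    exact LieSuperModule.act_bracket_eq_zero (LinearMap.ext fun m => by rw [← hT, ha p hp]) _
  refine ⟨I, hI, ?_, fun k m => ?_⟩
  · let Φ : A →ₗ[ℂ] S → g →ₗ[ℂ] M →ₗ[ℂ] M :=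
      LinearMap.pi fun p => T.flip ∘ₗ LinearMap.mulRight ℂ p.1.1
    have hΦ : LinearMap.ker Φ ≤ I.restrictScalars ℂ := fun a ha => hker a fun p hp x =>
      LinearMap.congr_fun (congrFun (LinearMap.mem_ker.1 ha) ⟨p, hp⟩) x
    have := Module.Finite.equiv Φ.quotKerEquivRange.symm
    exact Module.Finite.of_surjective
      (Submodule.factor hΦ : (A ⧸ LinearMap.ker Φ) →ₗ[ℂ] A ⧸ I.restrictScalars ℂ)
      (Submodule.factor_surjective hΦ)
  -- Each element of `(g ⊗ I)^Γ` is a trace, and for a pure tensor the definition of `I` with `b =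
  -- 1` applies.
  · rw [← eqTrace_surjective_apply ρ (idealRep hI) k, eqIncl_eqTrace]
    generalize (Fintype.card Γ : ℂ)⁻¹ • k.1 = w
    induction w with
    | zero => simp
    | add v w hv hw => simp only [map_add, LinearMap.add_apply, hv, hw, add_zero]
    | tmul x a =>
      rw [LinearMap.lTensor_tmul]
      have h := a.2 x 1
      rw [mul_one, hT] at h
      exact LinearMap.congr_fun h m

variable (ρ) in
/-- The kernel of `(g ⊗ I)^Γ → (g ⊗ I/I²)^Γ` is contained in `[(g ⊗ I)^Γ, (g ⊗ I)^Γ]`. -/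
theorem eqIncl_mem_span_bracket [Finite Γ] (hg : LieSuperalgebra.IsSimple g)
    (hfree : ∀ (γ : Γ) (m : Ideal A), m.IsMaximal → m.map (α γ : A →+* A) = m → γ = 1)
    {I : Ideal A} (hI : IsInvariantIdeal α I) {k : eqMap ρ (idealRep hI)}
    (hk : eqToCotangent ρ hI k = 0) :
    eqIncl ρ hI k ∈ Submodule.span ℂ
      (Set.range fun p : eqMap ρ (idealRep hI) × eqMap ρ (idealRep hI) =>
        bracket (eqIncl ρ hI p.1) (eqIncl ρ hI p.2)) := by
  classical
  have := Fintype.ofFinite Γ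
  obtain ⟨S, hS⟩ := exists_galoisCoordinates hfree
  have hS0 : ∀ γ, γ ≠ 1 → ∑ p ∈ S, p.1 * α γ p.2 = 0 := fun γ hγ => by rw [hS, if_neg hγ]
  have hS1 : ∑ p ∈ S, p.1 * p.2 = 1 := by simpa using hS 1
  set J := Submodule.span ℂ (Set.range fun p : eqMap ρ (idealRep hI) × eqMap ρ (idealRep hI) =>
    bracket (eqIncl ρ hI p.1) (eqIncl ρ hI p.2))
  have tr : ∀ (x : g) (a : I), eqTrace ρ (algRep α) (x ⊗ₜ a.1)
      = eqIncl ρ hI (eqTrace ρ (idealRep hI) (x ⊗ₜ a)) := fun x a => by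
    rw [eqIncl_eqTrace]
    rfl
  have h1 : ∀ (x : g) (a b : A), a ∈ I → b ∈ I →
      eqTrace ρ (algRep α) (x ⊗ₜ (a * b)) ∈ J := by
    intro x a b ha hb
    have hx : x ∈ Submodule.span ℂ (Set.range fun p : g × g => bracket p.1 p.2) := by
      rw [hg.span_bracket_eq_top]
      trivial
    refine (Submodule.span_le (p := J.comap
      (eqTrace ρ (algRep α) ∘ₗ (TensorProduct.mk ℂ g A).flip (a * b)))).2 ?_ hx
    rintro _ ⟨⟨x, y⟩, rfl⟩
    change eqTrace ρ (algRep α) (bracket x y ⊗ₜ (a * b)) ∈ J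
    rw [← sum_bracket_eqTrace hS0 hS1]
    refine sum_mem fun p _ => ?_
    -- Both `a * p.1` and `p.2 * b` stay in the ideal `I`, so both brackets' entries come from `(g ⊗
    -- I)^Γ`.
    rw [tr x ⟨a * p.1, I.mul_mem_right _ ha⟩, tr y ⟨p.2 * b, I.mul_mem_left _ hb⟩]
    exact Submodule.subset_span ⟨(_, _), rfl⟩
  have h2 : ∀ (x : g) (c : A), c ∈ I ^ 2 → eqTrace ρ (algRep α) (x ⊗ₜ c) ∈ J := by
    intro x c hc
    rw [pow_two] at hc
    induction hc using Submodule.mul_induction_on' with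
    | mem_mul_mem a ha b hb => exact h1 x a b ha hb
    | add a _ b _ ha hb => rw [TensorProduct.tmul_add, map_add]; exact add_mem ha hb
  -- Tensoring with `g` is exact, so `k` comes from `g ⊗ ker(I → I/I²)`, whose second factors lie in
  -- `I²`. Since `tr k = |Γ| k` with `|Γ|` invertible, the trace of this preimage decides the claim.
  have hex : Function.Exact
      ((LinearMap.ker (I.toCotangent.restrictScalars ℂ)).subtype.lTensor g)
      ((I.toCotangent.restrictScalars ℂ).lTensor g) :=
    lTensor_exact g (LinearMap.exact_subtype_ker_map _) I.toCotangent_surjective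
  obtain ⟨w, hw⟩ := (hex k.1).1 (congrArg Subtype.val hk)
  have hc : (Fintype.card Γ : ℂ) ≠ 0 := by simp
  rw [← J.smul_mem_iff hc, ← map_smul, ← eqTrace_of_mem ρ (idealRep hI), eqIncl_eqTrace,
    ← hw]
  clear hw
  induction w with
  | zero => simp only [map_zero]; exact zero_mem _
  | add v w hv hw => simp only [map_add]; exact add_mem hv hw
  | tmul x a =>
    simp only [LinearMap.lTensor_tmul]
    exact h2 x _ ((Ideal.toCotangent_eq_zero I a.1).1 a.2)

end Main

end

theorem mainTheorem4 {g A Γ M : Type*}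
    [AddCommGroup g] [Module ℂ g] [LieSuperalgebra g] [FiniteDimensional ℂ g]
    (hg : LieSuperalgebra.IsSimple g)
    [CommRing A] [Algebra ℂ A] [Algebra.FiniteType ℂ A]
    [CommGroup Γ] [Finite Γ]
    (ρ : Γ →* LieSuperalgebra.Aut g) (α : Γ →* (A ≃ₐ[ℂ] A))
    (hfree : ∀ (γ : Γ) (m : Ideal A), m.IsMaximal → m.map (α γ : A →+* A) = m → γ = 1)
    [AddCommGroup M] [Module ℂ M] [SuperSpace M] [FiniteDimensional ℂ M]
    [LieSuperModule (EquivariantMap ρ α) M] :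
    ∃ (I : Ideal A) (hI : IsInvariantIdeal α I) (_ : FiniteDimensional ℂ (A ⧸ I))
      (_ : LieSuperModule (QuotEquivariantMap ρ hI) M)
      (hM : ∀ (x : EquivariantMap ρ α) (m : M),
        LieSuperModule.act (eqProj ρ hI x) m = LieSuperModule.act x m),
      ∀ z : ZMod 2, Nonempty (H1 z (EquivariantMap ρ α) M ≃ₗ[ℂ]
        H1 z (QuotEquivariantMap ρ hI) M × LinearMap.ker (idealTransgression ρ hI hM z)) := by
  obtain ⟨I, hI, hfin, hact⟩ := exists_invariantIdeal_act_eq_zero (ρ := ρ) hg hfree M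
  let E := idealExtension ρ hI
  let _ : LieSuperModule (QuotEquivariantMap ρ hI) M := E.quotModule hact
  refine ⟨I, hI, hfin, E.quotModule hact, E.quotModule_act hact, fun z => ?_⟩
  -- Averaging over `Γ` keeps `I → I/I²` surjective on invariants.
  exact E.nonempty_H1_equiv z (E.quotModule_act hact)
    (eqMapMap_surjective ρ (β := idealRep hI) (β' := cotangentRep hI)
      (I.toCotangent.restrictScalars ℂ) (fun _ _ => rfl) I.toCotangent_surjective)
    fun k hk => eqIncl_mem_span_bracket ρ hg hfree hI hk
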